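/- Let $k$ be a commutative ring. A *bicomplex* $X$ is a family of $k$-modules $X_{p,q}$, $p\in\mathbb N$, $q\in\mathbb Z$ (with $X_{p,q}=0$ for $p<0$), with horizontal and vertical differentials $d_h\colon X_{p,q}\to X_{p-1,q}$ and $d_v\colon X_{p,q}\to X_{p,q-1}$ satisfying $d_h^2=0$, $d_v^2=0$ and $d_vd_h+d_hd_v=0$; a morphism is a family of linear maps $f_{p,q}\colon X_{p,q}\to Y_{p,q}$ commuting with $d_h$ and $d_v$. Let $\mathrm{bCh}$ be the category of bicomplexes. Write $Z^v_{p,q}(X)=\ker(d_v\colon X_{p,q}\to X_{p,q-1})$, $B^v_{p,q}(X)=\operatorname{im}(d_v\colon X_{p,q+1}\to X_{p,q})$ and $H^v_{p,q}(X)=Z^v_{p,q}(X)/B^v_{p,q}(X)$. For each $q$, $d_h$ makes $X_{*,q}$, $Z^v_{*,q}(X)$, $B^v_{*,q}(X)$ and $H^v_{*,q}(X)$ into non-negatively graded chain complexes; $H^h_{p,q}$ denotes their homology in degree $p$. **Theorem (Cartan–Eilenberg model structure).** There is a combinatorial model structure on $\mathrm{bCh}$ (that is, $\mathrm{bCh}$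 is complete, cocomplete and locally presentable, and the model structure has functorial factorizations and is cofibrantly generated by sets of morphisms that permit the small object argument) such that, for every morphism $f\colon X\to Y$ of bicomplexes: 1. $f$ is a weak equivalence if and only if $H^h_{p,q}(H^v(f))$ is an isomorphism for all $p\ge 0$, $q\in\mathbb Z$. 2. $f$ is a fibration if and only if $f_{p,q}$ is surjective for all $p\geq 0$ and $q\in\mathbb Z$, $Z^v_{p,q}(f)$ is surjective for all $p>0$ and $q\in\mathbb Z$, and $H^h_{p,q}(f)$ is an isomorphism for all $p\geq 0$ and $q\in\mathbb Z$. 3. $f$ is a trivial fibration (a fibration and a weak equivalence) if and only if it satisfies the three conditions in 2 and, in addition, $H^h_{p,q}(Z^v(f))$ is an isomorphism for all $p\geq 0$ and $q\in\mathbb Z$. 4. If $f$ is a cofibration, then for all $p\ge 0$ and $q\in\mathbb Z$ the maps $f_{p,q}$ and $H^v_{p,q}(f)$ are injective, and the cokernels of $B^v_{p,q}(f)$ and $H^v_{p,q}(f)$ are projective $k$-modules. -/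

import Mathlib

open CategoryTheory CategoryTheory.Limits HomotopicalAlgebra

universe w v u

/-- A bicomplex of `k`-modules concentrated in the right half-plane: modules `X p q` with `p : ℕ`
(horizontal degree) and `q : ℤ` (vertical degree), a horizontal differential
`X p q ⟶ X (p - 1) q` and a vertical differential `X p q ⟶ X p (q - 1)`, which square to zero and
anticommute. As for Mathlib's `HomologicalComplex`, the differentials `dh p p' q` and `dv p q q'`
are indexed by source and target and vanish unless `p' + 1 = p`, respectively `q' + 1 = q`. -/
structure Bicomplex (k : Type u) [CommRing k] where
  X : ℕ → ℤ → ModuleCat.{u} k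
  dh : ∀ (p p' : ℕ) (q : ℤ), X p q ⟶ X p' q
  dv : ∀ (p : ℕ) (q q' : ℤ), X p q ⟶ X p q'
  dh_shape : ∀ (p p' : ℕ) (q : ℤ), p' + 1 ≠ p → dh p p' q = 0
  dv_shape : ∀ (p : ℕ) (q q' : ℤ), q' + 1 ≠ q → dv p q q' = 0
  dh_dh : ∀ (p p' p'' : ℕ) (q : ℤ), dh p p' q ≫ dh p' p'' q = 0
  dv_dv : ∀ (p : ℕ) (q q' q'' : ℤ), dv p q q' ≫ dv p q' q'' = 0
  anticomm : ∀ (p p' : ℕ) (q q' : ℤ), dh p p' q ≫ dv p' q q' + dv p q q' ≫ dh p p' q' = 0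

namespace Bicomplex

variable {k : Type u} [CommRing k]

/-- A morphism of bicomplexes: a family of linear maps compatible with both differentials. -/
@[ext]
structure Hom (A B : Bicomplex k) where
  f : ∀ (p : ℕ) (q : ℤ), A.X p q ⟶ B.X p q
  comm_h : ∀ (p p' : ℕ) (q : ℤ), f p q ≫ B.dh p p' q = A.dh p p' q ≫ f p' q
  comm_v : ∀ (p : ℕ) (q q' : ℤ), f p q ≫ B.dv p q q' = A.dv p q q' ≫ f p q'

/-- The category of bicomplexes. -/
instance : Category (Bicomplex k) where
  Hom := Hom
  id A :=
    { f := fun _ _ => 𝟙 _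
      comm_h := by simp
      comm_v := by simp }
  comp φ ψ :=
    { f := fun p q => φ.f p q ≫ ψ.f p q
      comm_h := fun p p' q => by
        rw [Category.assoc, ψ.comm_h, ← Category.assoc, φ.comm_h, Category.assoc]
      comm_v := fun p q q' => by
        rw [Category.assoc, ψ.comm_v, ← Category.assoc, φ.comm_v, Category.assoc] }

@[simp]
lemma id_f (A : Bicomplex k) (p : ℕ) (q : ℤ) : Hom.f (𝟙 A) p q = 𝟙 (A.X p q) := rfl

@[simp]
lemma comp_f {A B C : Bicomplex k} (φ : A ⟶ B) (ψ : B ⟶ C) (p : ℕ) (q : ℤ) :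
    (φ ≫ ψ).f p q = φ.f p q ≫ ψ.f p q := rfl

section ElementForms

variable (A : Bicomplex k)

lemma dh_dh_apply (p p' p'' : ℕ) (q : ℤ) (x : A.X p q) :
    (A.dh p' p'' q).hom ((A.dh p p' q).hom x) = 0 := by
  have h := congrArg (fun g => g.hom x) (A.dh_dh p p' p'' q)
  simpa using h

lemma dv_dv_apply (p : ℕ) (q q' q'' : ℤ) (x : A.X p q) :
    (A.dv p q' q'').hom ((A.dv p q q').hom x) = 0 := by
  have h := congrArg (fun g => g.hom x) (A.dv_dv p q q' q'')
  simpa using h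

lemma dv_dh_apply (p p' : ℕ) (q q' : ℤ) (x : A.X p q) :
    (A.dv p' q q').hom ((A.dh p p' q).hom x) = - (A.dh p p' q').hom ((A.dv p q q').hom x) := by
  have h := congrArg (fun g => g.hom x) (A.anticomm p p' q q')
  exact eq_neg_of_add_eq_zero_left (by simpa using h)

variable {A} {B : Bicomplex k} (φ : A ⟶ B)

lemma comm_h_apply (p p' : ℕ) (q : ℤ) (x : A.X p q) :
    (B.dh p p' q).hom ((φ.f p q).hom x) = (φ.f p' q).hom ((A.dh p p' q).hom x) := by
  have h := congrArg (fun g => g.hom x) (φ.comm_h p p' q)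
  simpa using h

lemma comm_v_apply (p : ℕ) (q q' : ℤ) (x : A.X p q) :
    (B.dv p q q').hom ((φ.f p q).hom x) = (φ.f p q').hom ((A.dv p q q').hom x) := by
  have h := congrArg (fun g => g.hom x) (φ.comm_v p q q')
  simpa using h

end ElementForms

/-- The horizontal complex `X_{*,q}` of a bicomplex. -/
def row (q : ℤ) : Bicomplex k ⥤ ChainComplex (ModuleCat.{u} k) ℕ where
  obj A :=
    { X := fun p => A.X p q
      d := fun p p' => A.dh p p' q
      shape := fun p p' h => A.dh_shape p p' q h
      d_comp_d' := fun p p' p'' _ _ => A.dh_dh p p' p'' q }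
  map φ :=
    { f := fun p => φ.f p q
      comm' := fun p p' _ => φ.comm_h p p' q }

/-- The vertical cycles `Z^v_{p,q}(X)`: the kernel of the vertical differential. -/
def vCycles (A : Bicomplex k) (p : ℕ) (q : ℤ) : Submodule k (A.X p q) :=
  LinearMap.ker (A.dv p q (q - 1)).hom

/-- The vertical boundaries `B^v_{p,q}(X)`: the image of the vertical differential. -/
def vBoundaries (A : Bicomplex k) (p : ℕ) (q : ℤ) : Submodule k (A.X p q) :=
  LinearMap.range (A.dv p (q + 1) q).hom

/-- The vertical homology `H^v_{p,q}(X) = Z^v_{p,q}(X) / B^v_{p,q}(X)`. -/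
abbrev VHomology (A : Bicomplex k) (p : ℕ) (q : ℤ) : Type u :=
  A.vCycles p q ⧸ (A.vBoundaries p q).submoduleOf (A.vCycles p q)

lemma dh_mem_vCycles (A : Bicomplex k) (p p' : ℕ) (q : ℤ) :
    ∀ x ∈ A.vCycles p q, (A.dh p p' q).hom x ∈ A.vCycles p' q := by
  intro x hx
  have hx' : (A.dv p q (q - 1)).hom x = 0 := hx
  change (A.dv p' q (q - 1)).hom ((A.dh p p' q).hom x) = 0
  rw [dv_dh_apply, hx', map_zero, neg_zero]

lemma dh_mem_vBoundaries (A : Bicomplex k) (p p' : ℕ) (q : ℤ) :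
    ∀ x ∈ A.vBoundaries p q, (A.dh p p' q).hom x ∈ A.vBoundaries p' q := by
  rintro _ ⟨y, rfl⟩
  refine ⟨- (A.dh p p' (q + 1)).hom y, ?_⟩
  rw [map_neg, dv_dh_apply, neg_neg]

lemma map_mem_vCycles {A B : Bicomplex k} (φ : A ⟶ B) (p : ℕ) (q : ℤ) :
    ∀ x ∈ A.vCycles p q, (φ.f p q).hom x ∈ B.vCycles p q := by
  intro x hx
  have hx' : (A.dv p q (q - 1)).hom x = 0 := hx
  change (B.dv p q (q - 1)).hom ((φ.f p q).hom x) = 0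
  rw [comm_v_apply, hx', map_zero]

lemma map_mem_vBoundaries {A B : Bicomplex k} (φ : A ⟶ B) (p : ℕ) (q : ℤ) :
    ∀ x ∈ A.vBoundaries p q, (φ.f p q).hom x ∈ B.vBoundaries p q := by
  rintro _ ⟨y, rfl⟩
  exact ⟨(φ.f p (q + 1)).hom y, comm_v_apply φ p (q + 1) q y⟩

/-- The horizontal complex `Z^v_{*,q}(X)` of vertical cycles, with differential induced by `d_h`. -/
def vCyclesRow (q : ℤ) : Bicomplex k ⥤ ChainComplex (ModuleCat.{u} k) ℕ where
  obj A :=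
    { X := fun p => ModuleCat.of k (A.vCycles p q)
      d := fun p p' => ModuleCat.ofHom ((A.dh p p' q).hom.restrict (A.dh_mem_vCycles p p' q))
      shape := fun p p' h => by
        ext x
        change (A.dh p p' q).hom x.1 = 0
        rw [A.dh_shape p p' q h]
        rfl
      d_comp_d' := fun p p' p'' _ _ => by
        ext x
        exact A.dh_dh_apply p p' p'' q x.1 }
  map φ :=
    { f := fun p => ModuleCat.ofHom ((φ.f p q).hom.restrict (map_mem_vCycles φ p q))
      comm' := fun p p' _ => by
        ext x
        exact comm_h_apply φ p p' q x.1 }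

/-- The horizontal complex `B^v_{*,q}(X)` of vertical boundaries, with differential induced by
`d_h`. -/
def vBoundariesRow (q : ℤ) : Bicomplex k ⥤ ChainComplex (ModuleCat.{u} k) ℕ where
  obj A :=
    { X := fun p => ModuleCat.of k (A.vBoundaries p q)
      d := fun p p' => ModuleCat.ofHom ((A.dh p p' q).hom.restrict (A.dh_mem_vBoundaries p p' q))
      shape := fun p p' h => by
        ext x
        change (A.dh p p' q).hom x.1 = 0
        rw [A.dh_shape p p' q h]
        rfl
      d_comp_d' := fun p p' p'' _ _ => by
        ext x
        exact A.dh_dh_apply p p' p'' q x.1 }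
  map φ :=
    { f := fun p => ModuleCat.ofHom ((φ.f p q).hom.restrict (map_mem_vBoundaries φ p q))
      comm' := fun p p' _ => by
        ext x
        exact comm_h_apply φ p p' q x.1 }

/-- The horizontal complex `H^v_{*,q}(X)` of vertical homology, with differential induced by
`d_h`. -/
def vHomologyRow (q : ℤ) : Bicomplex k ⥤ ChainComplex (ModuleCat.{u} k) ℕ where
  obj A :=
    { X := fun p => ModuleCat.of k (A.VHomology p q)
      d := fun p p' => ModuleCat.ofHom (Submodule.mapQ _ _
        ((A.dh p p' q).hom.restrict (A.dh_mem_vCycles p p' q))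
        (fun x hx => A.dh_mem_vBoundaries p p' q x.1 hx))
      shape := fun p p' h => by
        ext x
        refine congrArg Submodule.Quotient.mk (a₂ := 0) ?_
        apply Subtype.ext
        change (A.dh p p' q).hom x.1 = 0
        rw [A.dh_shape p p' q h]
        rfl
      d_comp_d' := fun p p' p'' _ _ => by
        ext x
        refine congrArg Submodule.Quotient.mk (a₂ := 0) ?_
        exact Subtype.ext (A.dh_dh_apply p p' p'' q x.1) }
  map {A B} φ :=
    { f := fun p => ModuleCat.ofHom (Submodule.mapQ _ _
        ((φ.f p q).hom.restrict (map_mem_vCycles φ p q))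
        (fun x hx => map_mem_vBoundaries φ p q x.1 hx))
      comm' := fun p p' _ => by
        ext x
        exact congrArg Submodule.Quotient.mk <| Subtype.ext (comm_h_apply φ p p' q x.1) }
  map_id A := by
    ext p x
    rfl
  map_comp φ ψ := by
    ext p x
    rfl

/-- An isomorphism on horizontal homology, for a natural family of horizontal complexes
`F q : X ↦ (F q)(X)_{*}` (`row`, `vCyclesRow` or `vHomologyRow`): the map
`H^h_{p,q}(F(φ))` is an isomorphism for all `p ≥ 0` and all `q`. -/
def IsHorizontalHomologyIso (F : ℤ → Bicomplex k ⥤ ChainComplex (ModuleCat.{u} k) ℕ)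
    {A B : Bicomplex k} (φ : A ⟶ B) : Prop :=
  ∀ (p : ℕ) (q : ℤ), IsIso (HomologicalComplex.homologyMap ((F q).map φ) p)

end Bicomplex

/-- The map `g` of modules has projective cokernel. -/
def HasProjectiveCokernel {k : Type u} [CommRing k] {M N : ModuleCat.{u} k} (g : M ⟶ N) : Prop :=
  Module.Projective k (N ⧸ LinearMap.range g.hom)

/-- A combinatorial model category: a complete and cocomplete model category with functorial
factorizations which is locally presentable and cofibrantly generated. The latter means that there
are sets `I` and `J` of morphisms which permit the small object argument, such that the trivial
fibrations (respectively fibrations) are the morphisms having the right lifting property with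
respect to `I` (respectively `J`). -/
structure IsCombinatorialModelCategory (C : Type u) [Category.{v} C] [ModelCategory C] : Prop where
  hasLimits : HasLimitsOfSize.{w, w} C
  hasColimits : HasColimitsOfSize.{w, w} C
  functorialFactorization_trivialCofibrations :
    MorphismProperty.HasFunctorialFactorization (trivialCofibrations C) (fibrations C)
  functorialFactorization_trivialFibrations :
    MorphismProperty.HasFunctorialFactorization (cofibrations C) (trivialFibrations C)
  locallyPresentable : IsLocallyPresentable.{w} C
  cofibrantlyGenerated : ∃ I J : MorphismProperty C,
    MorphismProperty.IsSmall.{w} I ∧ MorphismProperty.IsSmall.{w} J ∧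
    MorphismProperty.HasSmallObjectArgument.{w} I ∧
    MorphismProperty.HasSmallObjectArgument.{w} J ∧
    trivialFibrations C = I.rlp ∧ fibrations C = J.rlp

/-! The model structure is generated by cells on one generator t, possibly with the relations d_h t
= 0 or d_v t = 0. Lifting against `genTrivCof` unwinds to `RowLift` (surjective, and a
quasi-isomorphism on each row) together with `CyclesSurjective`; lifting against `genCof` unwinds to
`RowLift` and `CyclesLift`, the same condition for the rows of vertical cycles. The cells are
finitely presentable, so the small object argument gives the factorizations. Two facts remain.

Fibrations that are weak equivalences have the right lifting property against `genCof`, and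
conversely (`fibration_and_weakEquivalence_iff`). Let K be the kernel, write Z, B, H for its
vertical cycles, boundaries and homology, and suppose surjectivity on all vertical cycles. The rows
of K are exact, so 0 → Z_{*,q+1} → K_{*,q+1} → B_{*,q} → 0 gives H^h_p(B_q) ≅ H^h_{p-1}(Z_{q+1}). If
H^h(H) = 0, then also H^h_p(Z_q) ≅ H^h_p(B_q), and H^h(Z) vanishes by induction on p, starting from
K_{-1} = 0. Conversely H^h(Z) = 0 forces H^h(B) = 0, hence H^h(H) = 0.

A map f : A → B with the left lifting property against fibrations is a weak equivalence
(`isHorizontalHomologyIso_of_llp`). Its cokernel C receives a fibration from `cone C` ⊕ `path C`: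
the cone has contractible columns, the path object has d_v = 0 and exact rows, so H^h H^v of the sum
is zero. Lifting B → C through it, with A going to 0, makes C a retract of the sum. To pass from C
to f, a vertical splitting is needed. It comes from `exists_cover_section`: lifting against a
suitable map of cofree bicomplexes exhibits B, as a family of vertical complexes, as a retract of A
plus a free part. The same splitting yields injectivity and projectivity of cokernels for
cofibrations.

The equality of trivial cofibrations with the maps lifting against fibrations then follows by the
retract argument. -/

namespace Bicomplex

variable {k : Type u} [CommRing k]

/-! ### Bicomplexes and morphisms given in consecutive degrees -/

@[ext]
lemma hom_ext {A B : Bicomplex k} {φ ψ : A ⟶ B} (h : ∀ p q, φ.f p q = ψ.f p q) : φ = ψ :=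
  Hom.ext (by funext p q; exact h p q)

lemma hom_ext_apply {A B : Bicomplex k} {φ ψ : A ⟶ B}
    (h : ∀ p q (x : A.X p q), (φ.f p q).hom x = (ψ.f p q).hom x) : φ = ψ :=
  hom_ext fun p q => ModuleCat.hom_ext (LinearMap.ext (h p q))

/-- A bicomplex is determined by its differentials between consecutive degrees. -/
def ofSucc (X : ℕ → ℤ → ModuleCat.{u} k) (h : ∀ p q, X (p + 1) q ⟶ X p q)
    (v : ∀ p q, X p (q + 1) ⟶ X p q) (hh : ∀ p q, h (p + 1) q ≫ h p q = 0)
    (vv : ∀ p q, v p (q + 1) ≫ v p q = 0)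
    (hv : ∀ p q, h p (q + 1) ≫ v p q + v (p + 1) q ≫ h p q = 0) : Bicomplex k where
  X := X
  dh p p' q := if e : p' + 1 = p then eqToHom (by rw [e]) ≫ h p' q else 0
  dv p q q' := if e : q' + 1 = q then eqToHom (by rw [e]) ≫ v p q' else 0
  dh_shape p p' q e := dif_neg e
  dv_shape p q q' e := dif_neg e
  dh_dh p p' p'' q := by
    split_ifs with h₁ h₂
    · subst h₁ h₂
      simp [hh]
    all_goals simp
  dv_dv p q q' q'' := by
    split_ifs with h₁ h₂
    · subst h₁ h₂
      simp [vv]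
    all_goals simp
  anticomm p p' q q' := by
    split_ifs with h₁ h₂
    · subst h₁ h₂
      simpa using hv _ _
    all_goals simp

section

variable (X : ℕ → ℤ → ModuleCat.{u} k) (h : ∀ p q, X (p + 1) q ⟶ X p q)
    (v : ∀ p q, X p (q + 1) ⟶ X p q) (hh : ∀ p q, h (p + 1) q ≫ h p q = 0)
    (vv : ∀ p q, v p (q + 1) ≫ v p q = 0)
    (hv : ∀ p q, h p (q + 1) ≫ v p q + v (p + 1) q ≫ h p q = 0)

lemma ofSucc_dh (p : ℕ) (q : ℤ) : (ofSucc X h v hh vv hv).dh (p + 1) p q = h p q := by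
  simp [ofSucc]

lemma ofSucc_dv (p : ℕ) (q : ℤ) : (ofSucc X h v hh vv hv).dv p (q + 1) q = v p q := by
  simp [ofSucc]

lemma ofSucc_dh_apply (p : ℕ) (q : ℤ) (x : X (p + 1) q) :
    ((ofSucc X h v hh vv hv).dh (p + 1) p q).hom x = (h p q).hom x :=
  congrArg (fun g => g.hom x) (ofSucc_dh X h v hh vv hv p q)

lemma ofSucc_dv_apply (p : ℕ) (q : ℤ) (x : X p (q + 1)) :
    ((ofSucc X h v hh vv hv).dv p (q + 1) q).hom x = (v p q).hom x :=
  congrArg (fun g => g.hom x) (ofSucc_dv X h v hh vv hv p q)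

end

/-- A morphism of bicomplexes only has to commute with the differentials between consecutive
degrees. -/
def homMk {A B : Bicomplex k} (f : ∀ p q, A.X p q ⟶ B.X p q)
    (hh : ∀ p q, f (p + 1) q ≫ B.dh (p + 1) p q = A.dh (p + 1) p q ≫ f p q)
    (hv : ∀ p q, f p (q + 1) ≫ B.dv p (q + 1) q = A.dv p (q + 1) q ≫ f p q) : A ⟶ B :=
  Hom.mk f
    (fun p p' q => by
      by_cases e : p' + 1 = p
      · subst e
        exact hh _ _
      · rw [A.dh_shape _ _ _ e, B.dh_shape _ _ _ e, comp_zero, zero_comp])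
    (fun p q q' => by
      by_cases e : q' + 1 = q
      · subst e
        exact hv _ _
      · rw [A.dv_shape _ _ _ e, B.dv_shape _ _ _ e, comp_zero, zero_comp])

/-- `homMk` for a family of linear maps, with the conditions expressed on elements. -/
def homMkLin {A B : Bicomplex k} (f : ∀ p q, A.X p q →ₗ[k] B.X p q)
    (hh : ∀ p q x, (B.dh (p + 1) p q).hom (f (p + 1) q x) = f p q ((A.dh (p + 1) p q).hom x))
    (hv : ∀ p q x, (B.dv p (q + 1) q).hom (f p (q + 1) x) = f p q ((A.dv p (q + 1) q).hom x)) :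
    A ⟶ B :=
  homMk (fun p q => ModuleCat.ofHom (f p q))
    (fun p q => ModuleCat.hom_ext (LinearMap.ext (hh p q)))
    (fun p q => ModuleCat.hom_ext (LinearMap.ext (hv p q)))

/-! ### Degreewise limits and colimits -/

/-- Evaluation of a bicomplex in a bidegree. -/
def ev (p : ℕ) (q : ℤ) : Bicomplex k ⥤ ModuleCat.{u} k where
  obj A := A.X p q
  map φ := φ.f p q

/-- The horizontal differential as a natural transformation. -/
def dhNat (p p' : ℕ) (q : ℤ) : ev (k := k) p q ⟶ ev p' q where
  app A := A.dh p p' q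
  naturality _ _ φ := φ.comm_h p p' q

/-- The vertical differential as a natural transformation. -/
def dvNat (p : ℕ) (q q' : ℤ) : ev (k := k) p q ⟶ ev p q' where
  app A := A.dv p q q'
  naturality _ _ φ := φ.comm_v p q q'

lemma dhNat_app_dhNat_app (A : Bicomplex k) (p p' p'' : ℕ) (q : ℤ) :
    (dhNat p p' q).app A ≫ (dhNat p' p'' q).app A = 0 := A.dh_dh p p' p'' q

lemma dvNat_app_dvNat_app (A : Bicomplex k) (p : ℕ) (q q' q'' : ℤ) :
    (dvNat p q q').app A ≫ (dvNat p q' q'').app A = 0 := A.dv_dv p q q' q''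

lemma dhNat_app_dhNat_app_assoc (A : Bicomplex k) (p p' p'' : ℕ) (q : ℤ) {Z : ModuleCat.{u} k}
    (h : (ev p'' q).obj A ⟶ Z) :
    (dhNat p p' q).app A ≫ (dhNat p' p'' q).app A ≫ h = 0 := by
  rw [← zero_comp (f := h), ← dhNat_app_dhNat_app A p p' p'' q, Category.assoc]

lemma dvNat_app_dvNat_app_assoc (A : Bicomplex k) (p : ℕ) (q q' q'' : ℤ) {Z : ModuleCat.{u} k}
    (h : (ev p q'').obj A ⟶ Z) :
    (dvNat p q q').app A ≫ (dvNat p q' q'').app A ≫ h = 0 := by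
  rw [← zero_comp (f := h), ← dvNat_app_dvNat_app A p q q' q'', Category.assoc]

lemma anticomm_app (A : Bicomplex k) (p p' : ℕ) (q q' : ℤ) :
    (dhNat p p' q).app A ≫ (dvNat p' q q').app A +
      (dvNat p q q').app A ≫ (dhNat p p' q').app A = 0 := A.anticomm p p' q q'

lemma dhNat_app_eq_zero (A : Bicomplex k) {p p' : ℕ} (q : ℤ) (h : p' + 1 ≠ p) :
    (dhNat p p' q).app A = 0 := A.dh_shape p p' q h

lemma dvNat_app_eq_zero (A : Bicomplex k) (p : ℕ) {q q' : ℤ} (h : q' + 1 ≠ q) :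
    (dvNat p q q').app A = 0 := A.dv_shape p q q' h

section Limits

variable {J : Type v} [Category.{w} J] (F : J ⥤ Bicomplex.{u} k)

/-- The degreewise limit of a diagram of bicomplexes. -/
noncomputable def limitObj [∀ p q, HasLimit (F ⋙ ev p q)] : Bicomplex k where
  X p q := limit (F ⋙ ev p q)
  dh p p' q := limMap (Functor.whiskerLeft F (dhNat p p' q))
  dv p q q' := limMap (Functor.whiskerLeft F (dvNat p q q'))
  dh_shape p p' q h := limit.hom_ext fun j => by
    simp only [limMap_π, Functor.whiskerLeft_app, dhNat_app_eq_zero _ _ h, comp_zero, zero_comp]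
  dv_shape p q q' h := limit.hom_ext fun j => by
    simp only [limMap_π, Functor.whiskerLeft_app, dvNat_app_eq_zero _ _ h, comp_zero, zero_comp]
  dh_dh p p' p'' q := limit.hom_ext fun j => by
    simp only [Category.assoc, limMap_π, limMap_π_assoc, Functor.whiskerLeft_app,
      dhNat_app_dhNat_app, comp_zero, zero_comp]
  dv_dv p q q' q'' := limit.hom_ext fun j => by
    simp only [Category.assoc, limMap_π, limMap_π_assoc, Functor.whiskerLeft_app,
      dvNat_app_dvNat_app, comp_zero, zero_comp]
  anticomm p p' q q' := limit.hom_ext fun j => by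
    simp only [Preadditive.add_comp, Category.assoc, limMap_π, limMap_π_assoc,
      Functor.whiskerLeft_app, ← Preadditive.comp_add, zero_comp]
    exact (congrArg (limit.π (F ⋙ ev p q) j ≫ ·) (anticomm_app (F.obj j) p p' q q')).trans comp_zero

lemma limit_lift_limMap {G H : Bicomplex.{u} k ⥤ ModuleCat.{u} k} (α : G ⟶ H) (s : Cone F)
    [HasLimit (F ⋙ G)] [HasLimit (F ⋙ H)] :
    limit.lift (F ⋙ G) (G.mapCone s) ≫ limMap (Functor.whiskerLeft F α) =
      α.app s.pt ≫ limit.lift (F ⋙ H) (H.mapCone s) :=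
  limit.hom_ext fun j => by simp

lemma colimMap_colimit_desc {G H : Bicomplex.{u} k ⥤ ModuleCat.{u} k} (α : G ⟶ H) (s : Cocone F)
    [HasColimit (F ⋙ G)] [HasColimit (F ⋙ H)] :
    colimMap (Functor.whiskerLeft F α) ≫ colimit.desc (F ⋙ H) (H.mapCocone s) =
      colimit.desc (F ⋙ G) (G.mapCocone s) ≫ α.app s.pt :=
  colimit.hom_ext fun j => by simp

/-- The limit cone. -/
noncomputable def limitCone [∀ p q, HasLimit (F ⋙ ev p q)] : Cone F where
  pt := limitObj F
  π :=
    { app j :=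
        Hom.mk (fun p q => limit.π (F ⋙ ev p q) j)
          (fun p p' q => (limMap_π (Functor.whiskerLeft F (dhNat p p' q)) j).symm)
          (fun p q q' => (limMap_π (Functor.whiskerLeft F (dvNat p q q')) j).symm)
      naturality i j φ := by
        refine hom_ext fun p q => ?_
        exact (Category.id_comp _).trans (limit.w (F ⋙ ev p q) φ).symm }

/-- The limit cone is universal. -/
noncomputable def isLimitLimitCone [∀ p q, HasLimit (F ⋙ ev p q)] : IsLimit (limitCone F) where
  lift s := Hom.mk (fun p q => limit.lift (F ⋙ ev p q) ((ev p q).mapCone s))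
    (fun p p' q => limit_lift_limMap F (dhNat p p' q) s)
    (fun p q q' => limit_lift_limMap F (dvNat p q q') s)
  fac s j := by
    refine hom_ext fun p q => ?_
    exact limit.lift_π ((ev p q).mapCone s) j
  uniq s m hm := by
    refine hom_ext fun p q => ?_
    refine limit.hom_ext fun j => ?_
    refine Eq.trans ?_ (limit.lift_π ((ev p q).mapCone s) j).symm
    exact congrArg (fun g => Hom.f g p q) (hm j)

/-- The degreewise colimit of a diagram of bicomplexes. -/
noncomputable def colimitObj [∀ p q, HasColimit (F ⋙ ev p q)] : Bicomplex k where
  X p q := colimit (F ⋙ ev p q)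
  dh p p' q := colimMap (Functor.whiskerLeft F (dhNat p p' q))
  dv p q q' := colimMap (Functor.whiskerLeft F (dvNat p q q'))
  dh_shape p p' q h := colimit.hom_ext fun j => by
    simp only [ι_colimMap, Functor.whiskerLeft_app, dhNat_app_eq_zero _ _ h, comp_zero, zero_comp]
  dv_shape p q q' h := colimit.hom_ext fun j => by
    simp only [ι_colimMap, Functor.whiskerLeft_app, dvNat_app_eq_zero _ _ h, comp_zero, zero_comp]
  dh_dh p p' p'' q := colimit.hom_ext fun j => by
    simp only [ι_colimMap, ι_colimMap_assoc, Functor.whiskerLeft_app,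
      dhNat_app_dhNat_app_assoc, comp_zero]
  dv_dv p q q' q'' := colimit.hom_ext fun j => by
    simp only [ι_colimMap, ι_colimMap_assoc, Functor.whiskerLeft_app,
      dvNat_app_dvNat_app_assoc, comp_zero]
  anticomm p p' q q' := colimit.hom_ext fun j => by
    simp only [Preadditive.comp_add, ι_colimMap, ι_colimMap_assoc, Functor.whiskerLeft_app]
    simp only [← Category.assoc, ← Preadditive.add_comp, comp_zero]
    exact (congrArg (· ≫ colimit.ι (F ⋙ ev p' q') j) (anticomm_app (F.obj j) p p' q q')).trans
      zero_comp

/-- The colimit cocone. -/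
noncomputable def colimitCocone [∀ p q, HasColimit (F ⋙ ev p q)] : Cocone F where
  pt := colimitObj F
  ι :=
    { app j :=
        Hom.mk (fun p q => colimit.ι (F ⋙ ev p q) j)
          (fun p p' q => ι_colimMap (Functor.whiskerLeft F (dhNat p p' q)) j)
          (fun p q q' => ι_colimMap (Functor.whiskerLeft F (dvNat p q q')) j)
      naturality i j φ := by
        refine hom_ext fun p q => ?_
        exact (colimit.w (F ⋙ ev p q) φ).trans (Category.comp_id _).symm }

/-- The colimit cocone is universal. -/
noncomputable def isColimitColimitCocone [∀ p q, HasColimit (F ⋙ ev p q)] :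
    IsColimit (colimitCocone F) where
  desc s := Hom.mk (fun p q => colimit.desc (F ⋙ ev p q) ((ev p q).mapCocone s))
    (fun p p' q => (colimMap_colimit_desc F (dhNat p p' q) s).symm)
    (fun p q q' => (colimMap_colimit_desc F (dvNat p q q') s).symm)
  fac s j := by
    refine hom_ext fun p q => ?_
    exact colimit.ι_desc ((ev p q).mapCocone s) j
  uniq s m hm := by
    refine hom_ext fun p q => ?_
    refine colimit.hom_ext fun j => ?_
    refine Eq.trans ?_ (colimit.ι_desc ((ev p q).mapCocone s) j).symm
    exact congrArg (fun g => Hom.f g p q) (hm j)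

instance [∀ p q, HasLimit (F ⋙ ev p q)] : HasLimit F := ⟨⟨⟨_, isLimitLimitCone F⟩⟩⟩

instance [∀ p q, HasColimit (F ⋙ ev p q)] : HasColimit F := ⟨⟨⟨_, isColimitColimitCocone F⟩⟩⟩

/-- Colimits are built degreewise, so evaluation preserves them. This is what makes the free
bicomplex on one generator finitely presentable. -/
instance [∀ p q, HasColimit (F ⋙ ev p q)] (p : ℕ) (q : ℤ) :
    PreservesColimit F (ev p q) :=
  preservesColimit_of_preserves_colimit_cocone (isColimitColimitCocone F)
    ((IsColimit.equivOfNatIsoOfIso (Iso.refl _) _ _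
      (Cocone.ext (Iso.refl _) (fun _ => Category.comp_id _))) (colimit.isColimit (F ⋙ ev p q)))

end Limits

instance : HasLimitsOfSize.{u, u} (Bicomplex.{u} k) := ⟨fun _ => ⟨fun _ => inferInstance⟩⟩

instance : HasColimitsOfSize.{u, u} (Bicomplex.{u} k) := ⟨fun _ => ⟨fun _ => inferInstance⟩⟩

instance (p : ℕ) (q : ℤ) : PreservesColimitsOfSize.{u, u} (ev (k := k) p q) :=
  ⟨⟨inferInstance⟩⟩

instance : HasZeroMorphisms (Bicomplex.{u} k) where
  zero A B := ⟨Hom.mk (fun _ _ => 0) (by simp) (by simp)⟩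
  comp_zero _ _ := by
    refine hom_ext fun p q => ?_
    exact comp_zero
  zero_comp _ _ _ _ := by
    refine hom_ext fun p q => ?_
    exact zero_comp

lemma isIso_of_bijective {A B : Bicomplex k} (φ : A ⟶ B)
    (h : ∀ p q, Function.Bijective (φ.f p q).hom) : IsIso φ := by
  have : ∀ p q, IsIso (φ.f p q) := fun p q => (ConcreteCategory.isIso_iff_bijective _).2 (h p q)
  refine ⟨Hom.mk (fun p q => inv (φ.f p q)) (fun p p' q => ?_) (fun p q q' => ?_), ?_, ?_⟩
  · rw [IsIso.inv_comp_eq, ← Category.assoc, IsIso.eq_comp_inv, φ.comm_h]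
  · rw [IsIso.inv_comp_eq, ← Category.assoc, IsIso.eq_comp_inv, φ.comm_v]
  · refine hom_ext fun p q => ?_
    exact IsIso.hom_inv_id _
  · refine hom_ext fun p q => ?_
    exact IsIso.inv_hom_id _

end Bicomplex

/-! ### Lifting conditions and quasi-isomorphisms of chain complexes -/

namespace ChainLift

variable {k : Type u} [CommRing k] {K L : ChainComplex (ModuleCat.{u} k) ℕ} (φ : K ⟶ L)

lemma d_apply_comm (i j : ℕ) (x : K.X i) :
    (L.d i j).hom ((φ.f i).hom x) = (φ.f j).hom ((K.d i j).hom x) := by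
  have h := congrArg (fun g => g.hom x) (φ.comm i j)
  exact h

lemma d_d_apply (K : ChainComplex (ModuleCat.{u} k) ℕ) (i j l : ℕ) (x : K.X i) :
    (K.d j l).hom ((K.d i j).hom x) = 0 := by
  have h := congrArg (fun g => g.hom x) (K.d_comp_d i j l)
  exact h

lemma d_eq_zero (K : ChainComplex (ModuleCat.{u} k) ℕ) {i j : ℕ} (x : K.X i) (h : j + 1 ≠ i) :
    (K.d i j).hom x = 0 := by
  rw [K.shape i j h]
  rfl

lemma forall_d_eq_zero (K : ChainComplex (ModuleCat.{u} k) ℕ) {p : ℕ} {x : K.X (p + 1)}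
    (h : (K.d (p + 1) p).hom x = 0) (j : ℕ) : (K.d (p + 1) j).hom x = 0 := by
  by_cases e : j = p
  · subst e
    exact h
  · exact d_eq_zero K x (by omega)

lemma exists_iCycles_eq (K : ChainComplex (ModuleCat.{u} k) ℕ) {p : ℕ} {x : K.X p}
    (hx : ∀ j, (K.d p j).hom x = 0) : ∃ z : K.cycles p, (K.iCycles p).hom z = x :=
  (ShortComplex.moduleCat_exact_iff _).1
    (ShortComplex.exact_of_f_is_kernel (ShortComplex.mk _ _ (K.iCycles_d p _))
      (K.cyclesIsKernel p _ rfl)) x (hx _)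

lemma iCycles_injective (K : ChainComplex (ModuleCat.{u} k) ℕ) (p : ℕ) :
    Function.Injective (K.iCycles p).hom :=
  (ModuleCat.mono_iff_injective (K.iCycles p)).1 inferInstance

lemma d_iCycles_apply (K : ChainComplex (ModuleCat.{u} k) ℕ) (p j : ℕ) (z : K.cycles p) :
    (K.d p j).hom ((K.iCycles p).hom z) = 0 := by
  have h := congrArg (fun g => g.hom z) (K.iCycles_d p j)
  exact h

lemma homologyπ_surjective (K : ChainComplex (ModuleCat.{u} k) ℕ) (p : ℕ) :
    Function.Surjective (K.homologyπ p).hom :=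
  (ModuleCat.epi_iff_surjective (K.homologyπ p)).1 inferInstance

lemma homologyπ_eq_zero_iff (K : ChainComplex (ModuleCat.{u} k) ℕ) {p : ℕ} (z : K.cycles p) :
    (K.homologyπ p).hom z = 0 ↔ ∃ y, (K.d (p + 1) p).hom y = (K.iCycles p).hom z := by
  have hi (y) : (K.iCycles p).hom ((K.toCycles (p + 1) p).hom y) = (K.d (p + 1) p).hom y := by
    have h := congrArg (fun g => g.hom y) (K.toCycles_i (p + 1) p)
    exact h
  constructor
  · intro h
    obtain ⟨y, hy⟩ := (ShortComplex.moduleCat_exact_iff _).1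
      (ShortComplex.exact_of_g_is_cokernel (ShortComplex.mk _ _ (K.toCycles_comp_homologyπ _ p))
        (K.homologyIsCokernel (p + 1) p (ChainComplex.prev _ _))) z h
    exact ⟨y, by rw [← hi]; exact congrArg _ hy⟩
  · rintro ⟨y, hy⟩
    have e : z = (K.toCycles (p + 1) p).hom y := iCycles_injective K p (by rw [hi, hy])
    have h := congrArg (fun g => g.hom y) (K.toCycles_comp_homologyπ (p + 1) p)
    rw [e]
    exact h

lemma homologyMap_homologyπ (p : ℕ) (z : K.cycles p) :
    (HomologicalComplex.homologyMap φ p).hom ((K.homologyπ p).hom z) =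
      (L.homologyπ p).hom ((HomologicalComplex.cyclesMap φ p).hom z) := by
  have h := congrArg (fun g => g.hom z) (HomologicalComplex.homologyπ_naturality φ p)
  exact h

lemma iCycles_cyclesMap (p : ℕ) (z : K.cycles p) :
    (L.iCycles p).hom ((HomologicalComplex.cyclesMap φ p).hom z) =
      (φ.f p).hom ((K.iCycles p).hom z) := by
  have h := congrArg (fun g => g.hom z) (HomologicalComplex.cyclesMap_i φ p)
  exact h

/-- Injectivity on homology in terms of elements. -/
def HomologyInjective (p : ℕ) : Prop :=
  ∀ x : K.X p, (∀ j, (K.d p j).hom x = 0) → (∃ y, (L.d (p + 1) p).hom y = (φ.f p).hom x) →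
    ∃ x', (K.d (p + 1) p).hom x' = x

/-- Surjectivity on homology in terms of elements. -/
def HomologySurjective (p : ℕ) : Prop :=
  ∀ y : L.X p, (∀ j, (L.d p j).hom y = 0) → ∃ x, (∀ j, (K.d p j).hom x = 0) ∧
    ∃ w, (φ.f p).hom x + (L.d (p + 1) p).hom w = y

/-- Translates homology into chains once and for all. Asking a cycle to be killed by `d p j` for
every `j` treats degree 0 like the others, since there the condition is vacuous. -/
lemma isIso_homologyMap_iff (p : ℕ) : IsIso (HomologicalComplex.homologyMap φ p) ↔
    HomologyInjective φ p ∧ HomologySurjective φ p := by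
  rw [ConcreteCategory.isIso_iff_bijective]
  change Function.Injective (HomologicalComplex.homologyMap φ p).hom ∧
    Function.Surjective (HomologicalComplex.homologyMap φ p).hom ↔ _
  refine and_congr ?_ ?_
  · rw [injective_iff_map_eq_zero]
    constructor
    · rintro h x hx ⟨y, hy⟩
      obtain ⟨z, rfl⟩ := exists_iCycles_eq K hx
      refine (homologyπ_eq_zero_iff K z).1 (h _ ?_)
      rw [homologyMap_homologyπ, homologyπ_eq_zero_iff, iCycles_cyclesMap]
      exact ⟨y, hy⟩
    · intro h a ha
      obtain ⟨z, rfl⟩ := homologyπ_surjective K p a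
      rw [homologyMap_homologyπ, homologyπ_eq_zero_iff, iCycles_cyclesMap] at ha
      exact (homologyπ_eq_zero_iff K z).2 (h _ (fun j => d_iCycles_apply K p j z) ha)
  · constructor
    · intro h y hy
      obtain ⟨z, rfl⟩ := exists_iCycles_eq L hy
      obtain ⟨a, ha⟩ := h ((L.homologyπ p).hom z)
      obtain ⟨t, rfl⟩ := homologyπ_surjective K p a
      rw [homologyMap_homologyπ, eq_comm, ← sub_eq_zero, ← map_sub, homologyπ_eq_zero_iff] at ha
      obtain ⟨w, hw⟩ := ha
      refine ⟨_, fun j => d_iCycles_apply K p j t, w, ?_⟩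
      rw [hw, map_sub, iCycles_cyclesMap]
      abel
    · intro h b
      obtain ⟨z, rfl⟩ := homologyπ_surjective L p b
      obtain ⟨x, hx, w, hw⟩ := h _ (fun j => d_iCycles_apply L p j z)
      obtain ⟨t, rfl⟩ := exists_iCycles_eq K hx
      refine ⟨(K.homologyπ p).hom t, ?_⟩
      rw [homologyMap_homologyπ, eq_comm, ← sub_eq_zero, ← map_sub, homologyπ_eq_zero_iff]
      exact ⟨w, by rw [map_sub, iCycles_cyclesMap, ← hw]; abel⟩

/-- The elementwise right lifting property against the inclusions of spheres into disks. -/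
structure HasLift : Prop where
  zero : ∀ y : L.X 0, ∃ x, (φ.f 0).hom x = y
  succ : ∀ (p : ℕ) (x : K.X p) (y : L.X (p + 1)), (∀ j, (K.d p j).hom x = 0) →
    (L.d (p + 1) p).hom y = (φ.f p).hom x →
      ∃ x', (K.d (p + 1) p).hom x' = x ∧ (φ.f (p + 1)).hom x' = y

variable {φ}

lemma HasLift.exists_cycle (h : HasLift φ) {p : ℕ} (y : L.X p)
    (hy : ∀ j, (L.d p j).hom y = 0) :
    ∃ x, (∀ j, (K.d p j).hom x = 0) ∧ (φ.f p).hom x = y := by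
  obtain _ | p := p
  · obtain ⟨x, hx⟩ := h.zero y
    exact ⟨x, fun j => d_eq_zero K x (by omega), hx⟩
  · obtain ⟨x, hx, hx'⟩ := h.succ p 0 y (by simp) (by rw [hy, map_zero])
    exact ⟨x, forall_d_eq_zero K hx, hx'⟩

lemma HasLift.surjective (h : HasLift φ) (p : ℕ) : Function.Surjective (φ.f p).hom := by
  intro y
  obtain _ | p := p
  · exact h.zero y
  · obtain ⟨x, hx, hx'⟩ := h.exists_cycle ((L.d (p + 1) p).hom y)
      (fun j => d_d_apply L _ _ _ _)
    obtain ⟨x', _, e⟩ := h.succ p x y hx hx'.symm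
    exact ⟨x', e⟩

/-- The usual description of trivial fibrations of non-negative chain complexes. Surjectivity in
degree 0 comes for free, because every element of degree 0 is a cycle. -/
lemma hasLift_iff : HasLift φ ↔ (∀ p, 0 < p → Function.Surjective (φ.f p).hom) ∧
    ∀ p, IsIso (HomologicalComplex.homologyMap φ p) := by
  simp only [isIso_homologyMap_iff]
  constructor
  · refine fun h => ⟨fun p _ => h.surjective p, fun p => ⟨?_, ?_⟩⟩
    · rintro x hx ⟨y, hy⟩
      obtain ⟨x', hx', _⟩ := h.succ p x y hx hy
      exact ⟨x', hx'⟩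
    · intro y hy
      obtain ⟨x, hx, e⟩ := h.exists_cycle y hy
      exact ⟨x, hx, 0, by rw [map_zero, add_zero, e]⟩
  · rintro ⟨hs, hi⟩
    -- Every cycle lifts to a cycle: homology lifts it up to a boundary `d w`, and `w` itself lifts
    -- because its degree is positive.
    have key (p : ℕ) (y : L.X p) (hy : ∀ j, (L.d p j).hom y = 0) :
        ∃ x, (∀ j, (K.d p j).hom x = 0) ∧ (φ.f p).hom x = y := by
      obtain ⟨x, hx, w, hw⟩ := (hi p).2 y hy
      obtain ⟨w', rfl⟩ := hs (p + 1) p.succ_pos w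
      refine ⟨x + (K.d (p + 1) p).hom w', fun j => ?_, ?_⟩
      · rw [map_add, hx, d_d_apply, add_zero]
      · rw [map_add, ← d_apply_comm, hw]
    refine ⟨fun y => ?_, fun p x y hx hy => ?_⟩
    · obtain ⟨x, _, hx⟩ := key 0 y (fun j => d_eq_zero L y (by omega))
      exact ⟨x, hx⟩
    -- A first preimage `x₁` of `x` has the wrong image, but the error is a cycle and lifts to a
    -- cycle.
    · obtain ⟨x₁, rfl⟩ := (hi p).1 x hx ⟨y, hy⟩
      obtain ⟨x₂, h₂, e⟩ := key (p + 1) (y - (φ.f (p + 1)).hom x₁)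
        (forall_d_eq_zero L (by rw [map_sub, d_apply_comm, hy, sub_self]))
      exact ⟨x₁ + x₂, by rw [map_add, h₂, add_zero], by rw [map_add, e]; abel⟩

lemma hasLift_iff_surjective : HasLift φ ↔ (∀ p, Function.Surjective (φ.f p).hom) ∧
    ∀ p, IsIso (HomologicalComplex.homologyMap φ p) :=
  ⟨fun h => ⟨h.surjective, (hasLift_iff.1 h).2⟩, fun h => hasLift_iff.2 ⟨fun p _ => h.1 p, h.2⟩⟩

end ChainLift

/-! ### Elementwise description of fibrations and trivial fibrations -/

namespace Bicomplex

open ChainLift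

variable {k : Type u} [CommRing k]

section Elements

variable (A : Bicomplex k)

lemma dh_apply_eq_zero {p p' : ℕ} {q : ℤ} (x : A.X p q) (h : p' + 1 ≠ p) :
    (A.dh p p' q).hom x = 0 := by
  rw [A.dh_shape _ _ _ h]
  rfl

lemma dv_apply_eq_zero {p : ℕ} {q q' : ℤ} (x : A.X p q) (h : q' + 1 ≠ q) :
    (A.dv p q q').hom x = 0 := by
  rw [A.dv_shape _ _ _ h]
  rfl

variable {A}

lemma mem_vCycles_iff {p : ℕ} {q : ℤ} {x : A.X p q} :
    x ∈ A.vCycles p q ↔ ∀ q', (A.dv p q q').hom x = 0 := by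
  refine ⟨fun h q' => ?_, fun h => h _⟩
  by_cases e : q' = q - 1
  · subst e
    exact h
  · exact A.dv_apply_eq_zero x (by omega)

lemma mem_vCycles_succ {p : ℕ} {q : ℤ} {x : A.X p (q + 1)} :
    x ∈ A.vCycles p (q + 1) ↔ (A.dv p (q + 1) q).hom x = 0 := by
  refine ⟨fun h => mem_vCycles_iff.1 h q, fun h => mem_vCycles_iff.2 fun q' => ?_⟩
  by_cases e : q' = q
  · subst e
    exact h
  · exact A.dv_apply_eq_zero x (by omega)

lemma dv_mem_vCycles {p : ℕ} {q q' : ℤ} (u : A.X p q') : (A.dv p q' q).hom u ∈ A.vCycles p q :=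
  A.dv_dv_apply _ _ _ _ u

lemma forall_dh_eq_zero {p : ℕ} {q : ℤ} {x : A.X (p + 1) q}
    (h : (A.dh (p + 1) p q).hom x = 0) (j : ℕ) : (A.dh (p + 1) j q).hom x = 0 := by
  by_cases e : j = p
  · subst e
    exact h
  · exact A.dh_apply_eq_zero x (by omega)

/-- The class of a vertical cycle in vertical homology. -/
def vClass {p : ℕ} {q : ℤ} (x : A.X p q) (hx : x ∈ A.vCycles p q) : A.VHomology p q :=
  Submodule.Quotient.mk ⟨x, hx⟩

lemma exists_vClass {p : ℕ} {q : ℤ} (a : A.VHomology p q) :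
    ∃ x hx, vClass (A := A) x hx = a := by
  obtain ⟨⟨x, hx⟩, rfl⟩ := Submodule.Quotient.mk_surjective _ a
  exact ⟨x, hx, rfl⟩

lemma vClass_eq_iff {p : ℕ} {q : ℤ} {x y : A.X p q} {hx : x ∈ A.vCycles p q}
    {hy : y ∈ A.vCycles p q} :
    vClass x hx = vClass y hy ↔ ∃ u, x = y + (A.dv p (q + 1) q).hom u := by
  refine (Submodule.Quotient.eq _).trans ?_
  change (∃ u, (A.dv p (q + 1) q).hom u = x - y) ↔ _
  exact exists_congr fun u => by rw [eq_sub_iff_add_eq, add_comm, eq_comm]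

lemma vClass_eq_zero_iff {p : ℕ} {q : ℤ} {x : A.X p q} {hx : x ∈ A.vCycles p q} :
    vClass x hx = 0 ↔ ∃ u, x = (A.dv p (q + 1) q).hom u := by
  refine (vClass_eq_iff (hy := Submodule.zero_mem _)).trans ?_
  simp only [zero_add]

lemma vHomologyRow_d_eq_iff {p p' : ℕ} {q : ℤ} {x : A.X p q} {y : A.X p' q}
    {hx : x ∈ A.vCycles p q} {hy : y ∈ A.vCycles p' q} :
    (((vHomologyRow q).obj A).d p p').hom (vClass x hx) = vClass y hy ↔
      ∃ u, (A.dh p p' q).hom x = y + (A.dv p' (q + 1) q).hom u := vClass_eq_iff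

lemma vHomologyRow_d_eq_zero_iff {p p' : ℕ} {q : ℤ} {x : A.X p q} {hx : x ∈ A.vCycles p q} :
    (((vHomologyRow q).obj A).d p p').hom (vClass x hx) = 0 ↔
      ∃ u, (A.dh p p' q).hom x = (A.dv p' (q + 1) q).hom u := vClass_eq_zero_iff

variable {B : Bicomplex k} {f : A ⟶ B}

lemma vHomologyRow_map_eq_iff {p : ℕ} {q : ℤ} {x : A.X p q} {y : B.X p q}
    {hx : x ∈ A.vCycles p q} {hy : y ∈ B.vCycles p q} :
    (((vHomologyRow q).map f).f p).hom (vClass x hx) = vClass y hy ↔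
      ∃ u, (f.f p q).hom x = y + (B.dv p (q + 1) q).hom u := vClass_eq_iff

lemma vHomologyRow_map_eq_zero_iff {p : ℕ} {q : ℤ} {x : A.X p q} {hx : x ∈ A.vCycles p q} :
    (((vHomologyRow q).map f).f p).hom (vClass x hx) = 0 ↔
      ∃ u, (f.f p q).hom x = (B.dv p (q + 1) q).hom u := vClass_eq_zero_iff

lemma vHomologyRow_d_eq_map_iff {p p' : ℕ} {q : ℤ} {x : A.X p' q} {y : B.X p q}
    {hx : x ∈ A.vCycles p' q} {hy : y ∈ B.vCycles p q} :
    (((vHomologyRow q).obj B).d p p').hom (vClass y hy) =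
        (((vHomologyRow q).map f).f p').hom (vClass x hx) ↔
      ∃ u, (B.dh p p' q).hom y = (f.f p' q).hom x + (B.dv p' (q + 1) q).hom u := vClass_eq_iff

end Elements

variable {A B : Bicomplex k} (f : A ⟶ B)

/-- Elementwise form of: `f` is a degreewise surjection inducing an isomorphism on the homology
of the rows. -/
structure RowLift : Prop where
  zero : ∀ (q : ℤ) (y : B.X 0 q), ∃ x, (f.f 0 q).hom x = y
  succ : ∀ (p : ℕ) (q : ℤ) (x : A.X p q) (y : B.X (p + 1) q), (∀ j, (A.dh p j q).hom x = 0) →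
    (B.dh (p + 1) p q).hom y = (f.f p q).hom x →
      ∃ x', (A.dh (p + 1) p q).hom x' = x ∧ (f.f (p + 1) q).hom x' = y

/-- Elementwise form of: `f` is surjective on vertical cycles and induces an isomorphism on the
homology of the rows of vertical cycles. -/
structure CyclesLift : Prop where
  zero : ∀ (q : ℤ) (y : B.X 0 q), y ∈ B.vCycles 0 q → ∃ x ∈ A.vCycles 0 q, (f.f 0 q).hom x = y
  succ : ∀ (p : ℕ) (q : ℤ) (x : A.X p q) (y : B.X (p + 1) q), x ∈ A.vCycles p q →
    y ∈ B.vCycles (p + 1) q → (∀ j, (A.dh p j q).hom x = 0) →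
    (B.dh (p + 1) p q).hom y = (f.f p q).hom x →
      ∃ x' ∈ A.vCycles (p + 1) q, (A.dh (p + 1) p q).hom x' = x ∧ (f.f (p + 1) q).hom x' = y

/-- Surjectivity on vertical cycles in positive horizontal degrees. -/
def CyclesSurjective : Prop :=
  ∀ (p : ℕ) (q : ℤ) (y : B.X (p + 1) q), y ∈ B.vCycles (p + 1) q →
    ∃ x ∈ A.vCycles (p + 1) q, (f.f (p + 1) q).hom x = y

variable {f}

lemma rowLift_iff_hasLift : RowLift f ↔ ∀ q, HasLift ((row q).map f) :=
  ⟨fun h q => ⟨h.zero q, fun p => h.succ p q⟩,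
    fun h => ⟨fun q => (h q).zero, fun p q => (h q).succ p⟩⟩

lemma cyclesLift_iff_hasLift : CyclesLift f ↔ ∀ q, HasLift ((vCyclesRow q).map f) := by
  refine ⟨fun h q => ⟨?_, ?_⟩, fun h => ⟨fun q y hy => ?_, fun p q x y hx hy h₁ h₂ => ?_⟩⟩
  · rintro ⟨y, hy⟩
    obtain ⟨x, hx, e⟩ := h.zero q y hy
    exact ⟨⟨x, hx⟩, Subtype.ext e⟩
  · rintro p ⟨x, hx⟩ ⟨y, hy⟩ h₁ h₂
    obtain ⟨x', hx', e, e'⟩ := h.succ p q x y hx hy (fun j => congrArg Subtype.val (h₁ j))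
      (congrArg Subtype.val h₂)
    exact ⟨⟨x', hx'⟩, Subtype.ext e, Subtype.ext e'⟩
  · obtain ⟨x, e⟩ := (h q).zero ⟨y, hy⟩
    exact ⟨x.1, x.2, congrArg Subtype.val e⟩
  · obtain ⟨x', e, e'⟩ := (h q).succ p ⟨x, hx⟩ ⟨y, hy⟩ (fun j => Subtype.ext (h₁ j))
      (Subtype.ext h₂)
    exact ⟨x'.1, x'.2, congrArg Subtype.val e, congrArg Subtype.val e'⟩

lemma rowLift_iff : RowLift f ↔
    (∀ p q, Function.Surjective (f.f p q)) ∧ IsHorizontalHomologyIso row f := by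
  simp only [rowLift_iff_hasLift, hasLift_iff_surjective]
  exact ⟨fun h => ⟨fun p q => (h q).1 p, fun p q => (h q).2 p⟩,
    fun h q => ⟨fun p => h.1 p q, fun p => h.2 p q⟩⟩

lemma cyclesSurjective_iff : CyclesSurjective f ↔
    ∀ (p : ℕ) (q : ℤ), 0 < p → Function.Surjective (((vCyclesRow q).map f).f p) := by
  constructor
  · rintro h (_ | p) q hp ⟨y, hy⟩
    · simp at hp
    · obtain ⟨x, hx, e⟩ := h p q y hy
      exact ⟨⟨x, hx⟩, Subtype.ext e⟩
  · intro h p q y hy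
    obtain ⟨x, e⟩ := h (p + 1) q p.succ_pos ⟨y, hy⟩
    exact ⟨x.1, x.2, congrArg Subtype.val e⟩

lemma cyclesLift_iff : CyclesLift f ↔
    CyclesSurjective f ∧ IsHorizontalHomologyIso vCyclesRow f := by
  rw [cyclesSurjective_iff]
  simp only [cyclesLift_iff_hasLift, hasLift_iff]
  exact ⟨fun h => ⟨fun p q hp => (h q).1 p hp, fun p q => (h q).2 p⟩,
    fun h q => ⟨fun p hp => h.1 p q hp, fun p => h.2 p q⟩⟩

lemma RowLift.surjective (h : RowLift f) (p : ℕ) (q : ℤ) : Function.Surjective (f.f p q).hom :=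
  (rowLift_iff_hasLift.1 h q).surjective p

lemma CyclesLift.surjective (h : CyclesLift f) (p : ℕ) (q : ℤ) (y : B.X p q)
    (hy : y ∈ B.vCycles p q) : ∃ x ∈ A.vCycles p q, (f.f p q).hom x = y := by
  obtain ⟨x, e⟩ := (cyclesLift_iff_hasLift.1 h q).surjective p ⟨y, hy⟩
  exact ⟨x.1, x.2, congrArg Subtype.val e⟩

lemma RowLift.exists_of_mem_ker (h : RowLift f) {p : ℕ} {q : ℤ} (x : A.X p q)
    (hx : (f.f p q).hom x = 0) (hx' : ∀ j, (A.dh p j q).hom x = 0) :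
    ∃ x', (A.dh (p + 1) p q).hom x' = x ∧ (f.f (p + 1) q).hom x' = 0 :=
  h.succ p q x 0 hx' (by rw [hx, map_zero])

lemma CyclesLift.exists_of_mem_ker (h : CyclesLift f) {p : ℕ} {q : ℤ} (x : A.X p q)
    (hz : x ∈ A.vCycles p q) (hx : (f.f p q).hom x = 0) (hx' : ∀ j, (A.dh p j q).hom x = 0) :
    ∃ x' ∈ A.vCycles (p + 1) q, (A.dh (p + 1) p q).hom x' = x ∧ (f.f (p + 1) q).hom x' = 0 :=
  h.succ p q x 0 hz (Submodule.zero_mem _) hx' (by rw [hx, map_zero])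

/-- When vertical cycles lift, a vertical boundary lying in the kernel of f is a vertical boundary
of the kernel: correct `u` by a cycle with the same image. -/
lemma exists_dv_eq_of_map_dv_eq_zero {p : ℕ} {q : ℤ}
    (h : ∀ y ∈ B.vCycles p (q + 1), ∃ x ∈ A.vCycles p (q + 1), (f.f p (q + 1)).hom x = y)
    (u : A.X p (q + 1)) (hu : (f.f p q).hom ((A.dv p (q + 1) q).hom u) = 0) :
    ∃ u', (f.f p (q + 1)).hom u' = 0 ∧ (A.dv p (q + 1) q).hom u' = (A.dv p (q + 1) q).hom u := by
  obtain ⟨z, hz, e⟩ := h ((f.f p (q + 1)).hom u)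
    (mem_vCycles_succ.2 (by rw [comm_v_apply, hu]))
  exact ⟨u - z, by rw [map_sub, e, sub_self],
    by rw [map_sub, mem_vCycles_iff.1 hz, sub_zero]⟩

/-- The connecting map H^h_p(B_q) → H^h_{p-1}(Z_{q+1}) of the kernel, in the direction needed: if
the target class vanishes, so does the source class. Indeed d_h u is a vertical cycle, so it is d_h
u' with u' a vertical cycle; exactness of the row gives u - u' = d_h t, and then d_v u = d_v d_h t =
- d_h d_v t. -/
lemma exists_cycle_of_dv {p : ℕ} {q : ℤ} (hR : RowLift f)
    (hZ : ∀ (j : ℕ) (x : A.X j (q + 1)), j + 1 = p → x ∈ A.vCycles j (q + 1) →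
      (f.f j (q + 1)).hom x = 0 → (∀ i, (A.dh j i (q + 1)).hom x = 0) →
      ∃ x' ∈ A.vCycles (j + 1) (q + 1), (A.dh (j + 1) j (q + 1)).hom x' = x ∧
        (f.f (j + 1) (q + 1)).hom x' = 0)
    (u : A.X p (q + 1)) (hu : (f.f p (q + 1)).hom u = 0)
    (hx : ∀ j, (A.dh p j q).hom ((A.dv p (q + 1) q).hom u) = 0) :
    ∃ t : A.X (p + 1) (q + 1), (f.f (p + 1) (q + 1)).hom t = 0 ∧
      (A.dv p (q + 1) q).hom u = (A.dh (p + 1) p q).hom (- (A.dv (p + 1) (q + 1) q).hom t) := by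
  have key : ∃ u' ∈ A.vCycles p (q + 1), (f.f p (q + 1)).hom u' = 0 ∧
      ∀ j, (A.dh p j (q + 1)).hom (u - u') = 0 := by
    obtain _ | p := p
    -- In horizontal degree 0 there is nothing to correct; this is the base of the later induction.
    · exact ⟨0, Submodule.zero_mem _, map_zero _, fun j => A.dh_apply_eq_zero _ (by omega)⟩
    · obtain ⟨u', hu', e, e'⟩ := hZ p ((A.dh (p + 1) p (q + 1)).hom u) rfl
        (mem_vCycles_succ.2 (by rw [dv_dh_apply, hx, neg_zero]))
        (by rw [← comm_h_apply, hu, map_zero]) (fun i => A.dh_dh_apply _ _ _ _ u)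
      exact ⟨u', hu', e', forall_dh_eq_zero (by rw [map_sub, e, sub_self])⟩
  obtain ⟨u', hu', e, h⟩ := key
  obtain ⟨t, ht, ht'⟩ := hR.exists_of_mem_ker (u - u') (by rw [map_sub, hu, e, sub_self]) h
  refine ⟨t, ht', ?_⟩
  rw [map_neg, ← dv_dh_apply, ht, map_sub, mem_vCycles_iff.1 hu', sub_zero]

/-- A fibration which is a weak equivalence is surjective and a quasi-isomorphism on the rows of
vertical cycles. -/
lemma cyclesLift_of_vHomologyRow (hR : RowLift f) (hZ : CyclesSurjective f)
    (hH : IsHorizontalHomologyIso vHomologyRow f) : CyclesLift f := by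
  have hH' (q : ℤ) : HasLift ((vHomologyRow q).map f) := by
    refine hasLift_iff.2 ⟨fun p hp b => ?_, fun p => hH p q⟩
    obtain ⟨y, hy, rfl⟩ := exists_vClass b
    obtain _ | p := p
    · simp at hp
    · obtain ⟨x, hx, rfl⟩ := hZ p q y hy
      exact ⟨vClass x hx, rfl⟩
  -- Only degree 0 is new: a class in vertical homology lifts, and the remaining boundary lifts
  -- because f is surjective.
  have hS (p : ℕ) (q : ℤ) (y : B.X p q) (hy : y ∈ B.vCycles p q) :
      ∃ x ∈ A.vCycles p q, (f.f p q).hom x = y := by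
    obtain _ | p := p
    · obtain ⟨a, ha⟩ := (hH' q).zero (vClass y hy)
      obtain ⟨x, hx, rfl⟩ := exists_vClass a
      obtain ⟨u, hu⟩ := vHomologyRow_map_eq_iff.1 ha
      obtain ⟨u, rfl⟩ := hR.surjective _ _ u
      refine ⟨x - (A.dv 0 (q + 1) q).hom u, sub_mem hx (dv_mem_vCycles u), ?_⟩
      rw [map_sub, ← comm_v_apply, hu, add_sub_cancel_right]
    · exact hZ p q y hy
  -- Exactness of the rows of vertical cycles of the kernel, by induction on p for all q at once,
  -- since the induction passes from row q to row q + 1.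
  have hK (p : ℕ) : ∀ (q : ℤ) (x : A.X p q), x ∈ A.vCycles p q → (f.f p q).hom x = 0 →
      (∀ j, (A.dh p j q).hom x = 0) →
      ∃ x' ∈ A.vCycles (p + 1) q, (A.dh (p + 1) p q).hom x' = x ∧
        (f.f (p + 1) q).hom x' = 0 := by
    induction p using Nat.strong_induction_on with
    | _ p ih =>
    intro q x hx hfx hdx
    obtain ⟨a, ha, ha'⟩ := (hH' q).succ p (vClass x hx) 0
      (fun j => vHomologyRow_d_eq_zero_iff.2 ⟨0, by rw [hdx, map_zero]⟩)
      ((map_zero _).trans (vHomologyRow_map_eq_zero_iff.2 ⟨0, by rw [hfx, map_zero]⟩).symm)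
    obtain ⟨x₁, hx₁, rfl⟩ := exists_vClass a
    obtain ⟨u, hu⟩ := vHomologyRow_d_eq_iff.1 ha
    obtain ⟨y, hy⟩ := vHomologyRow_map_eq_zero_iff.1 ha'
    obtain ⟨y, rfl⟩ := hR.surjective _ _ y
    -- Vertical homology solves the problem up to boundaries. Subtracting `d_v y` moves the solution
    -- into the kernel, and what remains is to remove the boundary error in `e₂`.
    have e₁ : (f.f (p + 1) q).hom (x₁ - (A.dv (p + 1) (q + 1) q).hom y) = 0 := by
      rw [map_sub, hy, comm_v_apply, sub_self]
    have e₂ : (A.dh (p + 1) p q).hom (x₁ - (A.dv (p + 1) (q + 1) q).hom y) =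
        x + (A.dv p (q + 1) q).hom (u + (A.dh (p + 1) p (q + 1)).hom y) := by
      rw [map_sub, hu, map_add, dv_dh_apply]
      abel
    obtain ⟨u', h₁, h₂⟩ := exists_dv_eq_of_map_dv_eq_zero (hS p (q + 1))
      (u + (A.dh (p + 1) p (q + 1)).hom y) (by
        rw [← add_right_inj ((f.f p q).hom x), ← map_add, ← e₂, ← comm_h_apply, e₁, hfx,
          map_zero, add_zero])
    rw [← h₂] at e₂
    -- The error d_v u' is a horizontal cycle, so the induction hypothesis in degree p - 1 turns it
    -- into d_h of a vertical boundary of the kernel.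
    obtain ⟨t, ht, ht'⟩ := exists_cycle_of_dv hR
      (fun j z hj hz hz' hz'' => ih j (by omega) _ z hz hz' hz'') u' h₁ (fun j => by
        rw [← add_right_inj ((A.dh p j q).hom x), ← map_add, ← e₂, dh_dh_apply, hdx, add_zero])
    refine ⟨x₁ - (A.dv (p + 1) (q + 1) q).hom y + (A.dv (p + 1) (q + 1) q).hom t,
      add_mem (sub_mem hx₁ (dv_mem_vCycles _)) (dv_mem_vCycles _), ?_, ?_⟩
    · rw [map_add, e₂, ht', map_neg]
      abel
    · rw [map_add, e₁, ← comm_v_apply, ht, map_zero, add_zero]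
  refine ⟨hS 0, fun p q x y hx hy hdx e => ?_⟩
  obtain ⟨z, hz, rfl⟩ := hS _ q y hy
  obtain ⟨x', hx', h₁, h₂⟩ := hK p q (x - (A.dh (p + 1) p q).hom z)
    (sub_mem hx (A.dh_mem_vCycles _ _ _ _ hz)) (by rw [map_sub, ← e, comm_h_apply, sub_self])
    (fun j => by rw [map_sub, hdx, dh_dh_apply, sub_zero])
  exact ⟨z + x', add_mem hz hx', by rw [map_add, h₁, add_sub_cancel],
    by rw [map_add, h₂, add_zero]⟩

/-- A surjective quasi-isomorphism on rows and on rows of vertical cycles induces a surjective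
quasi-isomorphism on the rows of vertical homology. -/
lemma isHorizontalHomologyIso_vHomologyRow (hR : RowLift f) (hC : CyclesLift f) :
    IsHorizontalHomologyIso vHomologyRow f := by
  suffices h : ∀ q, HasLift ((vHomologyRow q).map f) from fun p q => (hasLift_iff.1 (h q)).2 p
  refine fun q => ⟨fun b => ?_, fun p a b ha hb => ?_⟩
  · obtain ⟨y, hy, rfl⟩ := exists_vClass b
    obtain ⟨x, hx, rfl⟩ := hC.zero q y hy
    exact ⟨vClass x hx, rfl⟩
  · obtain ⟨x, hx, rfl⟩ := exists_vClass a
    obtain ⟨y, hy, rfl⟩ := exists_vClass b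
    obtain ⟨z, hz, rfl⟩ := hC.surjective _ q y hy
    obtain ⟨w, hw⟩ := vHomologyRow_d_eq_map_iff.1 hb
    obtain ⟨w, rfl⟩ := hR.surjective _ _ w
    -- Subtracting a lift `z` of `y` and the boundary error reduces the lifting problem to the
    -- kernel of f.
    set x₁ := x - (A.dh (p + 1) p q).hom z + (A.dv p (q + 1) q).hom w with hx₁
    have hfx₁ : (f.f p q).hom x₁ = 0 := by
      rw [hx₁, map_add, map_sub, ← comm_h_apply, hw, comm_v_apply]
      abel
    have hzx₁ : x₁ ∈ A.vCycles p q :=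
      add_mem (sub_mem hx (A.dh_mem_vCycles _ _ _ _ hz)) (dv_mem_vCycles _)
    have hd : ∀ j, ∃ u, (A.dh p j q).hom x₁ = (A.dv j (q + 1) q).hom u := fun j => by
      obtain ⟨u, hu⟩ := vHomologyRow_d_eq_zero_iff.1 (ha j)
      refine ⟨u - (A.dh p j (q + 1)).hom w, ?_⟩
      rw [hx₁, map_add, map_sub, hu, dh_dh_apply, map_sub, dv_dh_apply]
      abel
    -- So far `x₁` is a horizontal cycle only modulo vertical boundaries. A boundary of the kernel
    -- makes it a strict one without changing its class.
    have key : ∃ t : A.X p (q + 1), (f.f p (q + 1)).hom t = 0 ∧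
        ∀ j, (A.dh p j q).hom (x₁ + (A.dv p (q + 1) q).hom t) = 0 := by
      obtain _ | p := p
      · exact ⟨0, map_zero _, fun j => A.dh_apply_eq_zero _ (by omega)⟩
      · obtain ⟨u, hu⟩ := hd p
        obtain ⟨u', h₁, h₂⟩ := exists_dv_eq_of_map_dv_eq_zero (hC.surjective p (q + 1)) u
          (by rw [← hu, ← comm_h_apply, hfx₁, map_zero])
        obtain ⟨t, ht, ht'⟩ := exists_cycle_of_dv hR
          (fun j z _ hz hz' hz'' => hC.exists_of_mem_ker z hz hz' hz'') u' h₁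
          (fun j => by rw [h₂, ← hu, dh_dh_apply])
        exact ⟨t, ht, forall_dh_eq_zero (by rw [map_add, hu, ← h₂, ht', map_neg, neg_add_cancel])⟩
    obtain ⟨t, ht, ht'⟩ := key
    obtain ⟨x', hx', e, e'⟩ := hC.exists_of_mem_ker (x₁ + (A.dv p (q + 1) q).hom t)
      (add_mem hzx₁ (dv_mem_vCycles _))
      (by rw [map_add, hfx₁, ← comm_v_apply, ht, map_zero, add_zero]) ht'
    refine ⟨vClass (z + x') (add_mem hz hx'), vHomologyRow_d_eq_iff.2 ⟨w + t, ?_⟩,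
      vHomologyRow_map_eq_iff.2 ⟨0, ?_⟩⟩
    · rw [map_add, e, hx₁, map_add]
      abel
    · rw [map_add, e', map_zero]

lemma fibration_and_weakEquivalence_iff :
    ((RowLift f ∧ CyclesSurjective f) ∧ IsHorizontalHomologyIso vHomologyRow f) ↔
      RowLift f ∧ CyclesLift f :=
  ⟨fun h => ⟨h.1.1, cyclesLift_of_vHomologyRow h.1.1 h.1.2 h.2⟩,
    fun h => ⟨⟨h.1, (cyclesLift_iff.1 h.2).1⟩, isHorizontalHomologyIso_vHomologyRow h.1 h.2⟩⟩

end Bicomplex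

/-! ### Free bicomplexes and bicomplexes on one generator -/

namespace Bicomplex

variable {k : Type u} [CommRing k]

section Free

variable (V : ℕ → ℤ → ModuleCat.{u} k)

/-- The free bicomplex on a bigraded module. -/
def free : Bicomplex k :=
  ofSucc (fun p q => ModuleCat.of k (V p q × V (p + 1) q × V p (q + 1) × V (p + 1) (q + 1)))
    (fun p q => ModuleCat.ofHom
      { toFun := fun x => (0, x.1, 0, x.2.2.1)
        map_add' := by simp
        map_smul' := by simp })
    (fun p q => ModuleCat.ofHom
      { toFun := fun x => (0, 0, x.1, - x.2.1)
        map_add' := by simp [add_comm]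
        map_smul' := by simp })
    (fun p q => by ext : 2 <;> rfl)
    (fun p q => by
      refine ModuleCat.hom_ext (LinearMap.ext fun x => ?_)
      change ((0, 0, 0, - 0) : V p q × V (p + 1) q × V p (q + 1) × V (p + 1) (q + 1)) = 0
      simp)
    (fun p q => by
      refine ModuleCat.hom_ext (LinearMap.ext fun x => ?_)
      change ((0, 0, 0, - x.1) + (0, 0, 0, x.1) :
        V p q × V (p + 1) q × V p (q + 1) × V (p + 1) (q + 1)) = 0
      simp)

/-- An element of the free bicomplex given by its four components. -/
def freeMk {p : ℕ} {q : ℤ} (a : V p q) (b : V (p + 1) q) (c : V p (q + 1))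
    (d : V (p + 1) (q + 1)) : (free V).X p q := (a, b, c, d)

variable {V}

lemma free_dh {p : ℕ} {q : ℤ} (a : V (p + 1) q) (b : V (p + 1 + 1) q) (c : V (p + 1) (q + 1))
    (d : V (p + 1 + 1) (q + 1)) :
    ((free V).dh (p + 1) p q).hom (freeMk V a b c d) = freeMk V 0 a 0 c :=
  ofSucc_dh_apply _ _ _ _ _ _ _ _ _

lemma free_dv {p : ℕ} {q : ℤ} (a : V p (q + 1)) (b : V (p + 1) (q + 1)) (c : V p (q + 1 + 1))
    (d : V (p + 1) (q + 1 + 1)) :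
    ((free V).dv p (q + 1) q).hom (freeMk V a b c d) = freeMk V 0 0 a (-b) :=
  ofSucc_dv_apply _ _ _ _ _ _ _ _ _

variable (V) in
/-- The inclusion of generators. -/
def freeLin (p : ℕ) (q : ℤ) : V p q →ₗ[k] (free V).X p q where
  toFun a := freeMk V a 0 0 0
  map_add' a b := by
    change _ = freeMk V (a + b) (0 + 0) (0 + 0) (0 + 0)
    simp only [add_zero]
  map_smul' r a := by
    change _ = freeMk V (r • a) (r • 0) (r • 0) (r • 0)
    simp only [smul_zero]

lemma freeMk_add {p : ℕ} {q : ℤ} (a a' : V p q) (b b' : V (p + 1) q) (c c' : V p (q + 1))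
    (d d' : V (p + 1) (q + 1)) :
    freeMk V a b c d + freeMk V a' b' c' d' = freeMk V (a + a') (b + b') (c + c') (d + d') := rfl

variable {A : Bicomplex k}

/-- The components of `freeDesc`. -/
def freeDescLin (g : ∀ p q, V p q →ₗ[k] A.X p q) (p : ℕ) (q : ℤ) :
    (V p q × V (p + 1) q × V p (q + 1) × V (p + 1) (q + 1)) →ₗ[k] A.X p q where
  toFun x := g p q x.1 + (A.dh (p + 1) p q).hom (g (p + 1) q x.2.1) +
    (A.dv p (q + 1) q).hom (g p (q + 1) x.2.2.1) +
    (A.dh (p + 1) p q).hom ((A.dv (p + 1) (q + 1) q).hom (g (p + 1) (q + 1) x.2.2.2))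
  map_add' x y := by
    simp only [Prod.fst_add, Prod.snd_add, map_add]
    abel
  map_smul' r x := by
    simp only [Prod.smul_fst, Prod.smul_snd, map_smul, smul_add, RingHom.id_apply]

lemma freeDescLin_apply (g : ∀ p q, V p q →ₗ[k] A.X p q) {p : ℕ} {q : ℤ} (a : V p q)
    (b : V (p + 1) q) (c : V p (q + 1)) (d : V (p + 1) (q + 1)) :
    freeDescLin g p q (a, b, c, d) = g p q a + (A.dh (p + 1) p q).hom (g (p + 1) q b) +
      (A.dv p (q + 1) q).hom (g p (q + 1) c) +
      (A.dh (p + 1) p q).hom ((A.dv (p + 1) (q + 1) q).hom (g (p + 1) (q + 1) d)) := rfl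

/-- The morphism from a free bicomplex given by a bigraded linear map. -/
def freeDesc (g : ∀ p q, V p q →ₗ[k] A.X p q) : free V ⟶ A :=
  homMkLin (A := free V) (freeDescLin g)
    (fun p q x => by
      obtain ⟨a, b, c, d⟩ := x
      refine Eq.trans ?_ (congrArg (freeDescLin g p q) (free_dh a b c d).symm)
      change (A.dh (p + 1) p q).hom (freeDescLin g (p + 1) q (a, b, c, d)) =
        freeDescLin g p q (0, a, 0, c)
      simp only [freeDescLin_apply, map_add, map_zero, dh_dh_apply]
      abel)
    (fun p q x => by
      obtain ⟨a, b, c, d⟩ := x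
      refine Eq.trans ?_ (congrArg (freeDescLin g p q) (free_dv a b c d).symm)
      change (A.dv p (q + 1) q).hom (freeDescLin g p (q + 1) (a, b, c, d)) =
        freeDescLin g p q (0, 0, a, -b)
      simp only [freeDescLin_apply, map_add, map_zero, dv_dv_apply, dv_dh_apply, map_neg]
      abel)

lemma freeDesc_apply (g : ∀ p q, V p q →ₗ[k] A.X p q) {p : ℕ} {q : ℤ} (a : V p q) :
    ((freeDesc g).f p q).hom (freeMk V a 0 0 0) = g p q a := by
  change g p q a + (A.dh (p + 1) p q).hom (g (p + 1) q 0) +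
      (A.dv p (q + 1) q).hom (g p (q + 1) 0) +
      (A.dh (p + 1) p q).hom ((A.dv (p + 1) (q + 1) q).hom (g (p + 1) (q + 1) 0)) = _
  simp

/-- The four components of the free bicomplex are a, d_h b, d_v c and d_h d_v d for generators a, b,
c, d. -/
lemma free_hom_ext {φ ψ : free V ⟶ A}
    (h : ∀ p q (a : V p q),
      (φ.f p q).hom (freeMk V a 0 0 0) = (ψ.f p q).hom (freeMk V a 0 0 0)) : φ = ψ := by
  refine hom_ext_apply fun p q x => ?_
  obtain ⟨a, b, c, d⟩ := x
  have hb : freeMk V 0 b 0 0 = ((free V).dh (p + 1) p q).hom (freeMk V b 0 0 0) :=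
    (free_dh _ _ _ _).symm
  have hc (p : ℕ) (c : V p (q + 1)) :
      freeMk V 0 0 c 0 = ((free V).dv p (q + 1) q).hom (freeMk V c 0 0 0) := by
    rw [free_dv, neg_zero]
  have hd : freeMk V 0 0 0 d = ((free V).dh (p + 1) p q).hom (freeMk V 0 0 d 0) :=
    (free_dh _ _ _ _).symm
  have e : freeMk V a b c d =
      freeMk V a 0 0 0 + freeMk V 0 b 0 0 + freeMk V 0 0 c 0 + freeMk V 0 0 0 d := by
    simp only [freeMk_add, add_zero, zero_add]
  change (φ.f p q).hom (freeMk V a b c d) = (ψ.f p q).hom (freeMk V a b c d)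
  rw [e]
  simp only [map_add, hd, hb, hc, ← comm_h_apply, ← comm_v_apply, h]

end Free

/-- A bicomplex `T` with an element `t` such that morphisms from `T` are classified by the elements
satisfying `P`. -/
structure IsGenerated (T : Bicomplex k) {p : ℕ} {q : ℤ} (t : T.X p q)
    (P : ∀ A : Bicomplex k, A.X p q → Prop) : Prop where
  hom_ext : ∀ {A : Bicomplex k} {φ ψ : T ⟶ A}, (φ.f p q).hom t = (ψ.f p q).hom t → φ = ψ
  exists_hom : ∀ {A : Bicomplex k} (x : A.X p q), P A x → ∃ φ : T ⟶ A, (φ.f p q).hom t = x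
  prop : ∀ {A : Bicomplex k} (φ : T ⟶ A), P A ((φ.f p q).hom t)

variable (k) in
/-- The module `k` placed in a single bidegree. -/
noncomputable def single (p : ℕ) (q : ℤ) (p' : ℕ) (q' : ℤ) : ModuleCat.{u} k :=
  ModuleCat.of k ({_x : PUnit.{u + 1} // p' = p ∧ q' = q} →₀ k)

variable (k) in
/-- The free bicomplex on one generator. -/
noncomputable def freeOne (p : ℕ) (q : ℤ) : Bicomplex k := free (single k p q)

variable (k) in
/-- The generator of `freeOne k p q`. -/
noncomputable def freeGen (p : ℕ) (q : ℤ) : (freeOne k p q).X p q :=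
  freeMk _ (Finsupp.single ⟨⟨⟩, rfl, rfl⟩ (1 : k)) 0 0 0

lemma isGenerated_freeOne (p : ℕ) (q : ℤ) :
    IsGenerated (freeOne k p q) (freeGen k p q) (fun _ _ => True) where
  hom_ext {A φ ψ} h := free_hom_ext fun p' q' a => by
    let L (χ : free (single k p q) ⟶ A) :
        ({_x : PUnit.{u + 1} // p' = p ∧ q' = q} →₀ k) →ₗ[k] A.X p' q' :=
      (χ.f p' q').hom ∘ₗ freeLin (single k p q) p' q'
    have e : L φ = L ψ := by
      refine Finsupp.lhom_ext' fun s => LinearMap.ext_ring ?_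
      obtain ⟨⟨⟩, rfl, rfl⟩ := s
      exact h
    exact LinearMap.congr_fun e a
  exists_hom {A} x _ := by
    let g (p' : ℕ) (q' : ℤ) : {_x : PUnit.{u + 1} // p' = p ∧ q' = q} → A.X p' q' :=
      fun s => s.2.1.symm ▸ s.2.2.symm ▸ x
    refine ⟨freeDesc (V := single k p q) (fun p' q' => Finsupp.linearCombination k (g p' q')), ?_⟩
    refine (freeDesc_apply (V := single k p q) _ _).trans ?_
    exact (Finsupp.linearCombination_single k (1 : k) _).trans (one_smul k x)
  prop _ := trivial

/-- Imposes the further relation r = 0: the subobject generated by `r` is the image of a free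
bicomplex on one generator, so the quotient is a cokernel and stays finitely presentable. -/
lemma IsGenerated.quotient {T : Bicomplex.{u} k} {p : ℕ} {q : ℤ} {t : T.X p q}
    {P : ∀ A : Bicomplex k, A.X p q → Prop} (hT : IsGenerated T t P) {p' : ℕ} {q' : ℤ}
    {r : T.X p' q'} {φ : freeOne k p' q' ⟶ T} (hφ : (φ.f p' q').hom (freeGen k p' q') = r)
    {Q : ∀ A : Bicomplex k, A.X p q → Prop}
    (hQ : ∀ {A : Bicomplex k} (ψ : T ⟶ A),
      Q A ((ψ.f p q).hom t) ↔ (ψ.f p' q').hom r = 0)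
    (hPQ : ∀ {A : Bicomplex k} (x : A.X p q), Q A x → P A x) :
    IsGenerated (cokernel φ) ((Hom.f (cokernel.π φ) p q).hom t) Q where
  hom_ext {A ψ χ} h := by
    rw [← cancel_epi (cokernel.π φ)]
    exact hT.hom_ext h
  exists_hom {A} x hx := by
    obtain ⟨ψ, rfl⟩ := hT.exists_hom x (hPQ x hx)
    refine ⟨cokernel.desc φ ψ ((isGenerated_freeOne p' q').hom_ext ?_), ?_⟩
    · have := (hQ ψ).1 hx
      rw [← hφ] at this
      exact this
    · exact congrArg (fun χ => (Hom.f χ p q).hom t) (cokernel.π_desc φ ψ _)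
  prop {A} ψ := by
    refine (hQ (cokernel.π φ ≫ ψ)).2 ?_
    rw [← hφ]
    have h : φ ≫ cokernel.π φ ≫ ψ = 0 := by simp
    exact congrArg (fun χ => (Hom.f χ p' q').hom (freeGen k p' q')) h

/-- Every element of a bicomplex is the image of the generator of a free bicomplex. -/
noncomputable def elemHom {A : Bicomplex k} {p : ℕ} {q : ℤ} (x : A.X p q) : freeOne k p q ⟶ A :=
  ((isGenerated_freeOne p q).exists_hom x trivial).choose

lemma elemHom_gen {A : Bicomplex k} {p : ℕ} {q : ℤ} (x : A.X p q) :
    ((elemHom x).f p q).hom (freeGen k p q) = x :=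
  ((isGenerated_freeOne p q).exists_hom x trivial).choose_spec

section Presentable

open Cardinal

attribute [local instance] fact_isRegular_aleph0

/-- The functor represented by `freeOne k p q` is the underlying set in bidegree (p, q), which
commutes with filtered colimits. -/
lemma isCardinalPresentable_freeOne (p : ℕ) (q : ℤ) :
    IsCardinalPresentable.{u} (freeOne k p q) ℵ₀ := by
  let e : ev (k := k) p q ⋙ forget (ModuleCat.{u} k) ≅
      coyoneda.obj (Opposite.op (freeOne k p q)) :=
    NatIso.ofComponents (fun A =>
      { hom := TypeCat.ofHom (fun x => elemHom x)
        inv := TypeCat.ofHom (fun φ => (Hom.f φ p q).hom (freeGen k p q))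
        hom_inv_id := by
          ext x
          exact elemHom_gen x
        inv_hom_id := by
          ext φ
          exact (isGenerated_freeOne p q).hom_ext (elemHom_gen _) })
      (fun {A B} f => by
        ext x
        refine (isGenerated_freeOne p q).hom_ext ?_
        exact (elemHom_gen _).trans (congrArg (f.f p q).hom (elemHom_gen x)).symm)
  have : (forget (ModuleCat.{u} k)).IsCardinalAccessible (ℵ₀ : Cardinal.{u}) :=
    Functor.isFinitelyAccessible_iff_preservesFilteredColimits.2 inferInstance
  exact Functor.isCardinalAccessible_of_natIso e ℵ₀

end Presentable

end Bicomplex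

/-! ### Local presentability and the small object argument -/

namespace Bicomplex

open Cardinal MorphismProperty

variable {k : Type u} [CommRing k]

attribute [local instance] fact_isRegular_aleph0

instance : HasFiniteLimits (Bicomplex.{u} k) :=
  hasFiniteLimits_of_hasLimitsOfSize.{u, u} _

instance : HasFiniteColimits (Bicomplex.{u} k) :=
  hasFiniteColimits_of_hasColimitsOfSize.{u, u} _

lemma isCardinalPresentable_cokernel {S T : Bicomplex.{u} k} (φ : S ⟶ T)
    (hS : IsCardinalPresentable.{u} S ℵ₀) (hT : IsCardinalPresentable.{u} T ℵ₀) :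
    IsCardinalPresentable.{u} (cokernel φ) ℵ₀ := by
  have : ∀ j, IsCardinalPresentable.{u} ((parallelPair φ 0).obj j) ℵ₀ := by
    rintro (_ | _)
    · exact hS
    · exact hT
  refine isCardinalPresentable_of_isColimit _ (colimit.isColimit (parallelPair φ 0))
    (ℵ₀ : Cardinal.{u}) ?_
  simp only [hasCardinalLT_aleph0_iff]
  infer_instance

lemma hasSmallObjectArgument_of_presentable (I : MorphismProperty (Bicomplex.{u} k))
    [IsSmall.{u} I]
    (hI : ∀ {A B : Bicomplex.{u} k} (i : A ⟶ B), I i → IsCardinalPresentable.{u} A ℵ₀) :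
    HasSmallObjectArgument.{u} I := by
  have : Nonempty (ℵ₀ : Cardinal.{u}).ord.ToType := by simp
  let _ : OrderBot (ℵ₀ : Cardinal.{u}).ord.ToType := WellFoundedLT.toOrderBot _
  refine ⟨ℵ₀, inferInstance, inferInstance, { preservesColimit := ?_ }⟩
  intro A B X Y i hi f hf
  have := hI i hi
  have := preservesColimitsOfShape_of_isCardinalPresentable A (ℵ₀ : Cardinal.{u})
    (ℵ₀ : Cardinal.{u}).ord.ToType
  infer_instance

instance : IsLocallyPresentable.{u} (Bicomplex.{u} k) := by
  refine ⟨ℵ₀, inferInstance, ?_⟩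
  rw [IsCardinalLocallyPresentable.iff_exists_isStrongGenerator]
  refine ⟨ObjectProperty.ofObj (fun i : ℕ × ℤ => freeOne k i.1 i.2), inferInstance, ?_, ?_⟩
  -- Maps out of the free bicomplexes are elements: they separate morphisms, and a monomorphism
  -- through which all of them factor is bijective in each bidegree.
  · rw [ObjectProperty.isStrongGenerator_iff]
    refine ⟨fun A B φ ψ h => hom_ext_apply fun p q x => ?_, fun A B i _ h => ?_⟩
    · have e := h (freeOne k p q) ⟨(p, q)⟩ (elemHom x)
      rw [← elemHom_gen x]
      exact congrArg (fun χ => (Hom.f χ p q).hom (freeGen k p q)) e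
    · refine isIso_of_bijective i fun p q => ⟨fun x y hxy => ?_, fun y => ?_⟩
      · have e : elemHom x = elemHom y := by
          rw [← cancel_mono i]
          refine (isGenerated_freeOne p q).hom_ext ?_
          change (i.f p q).hom (((elemHom x).f p q).hom _) =
            (i.f p q).hom (((elemHom y).f p q).hom _)
          rw [elemHom_gen, elemHom_gen, hxy]
        rw [← elemHom_gen x, ← elemHom_gen y, e]
      · obtain ⟨φ, hφ⟩ := h (freeOne k p q) ⟨(p, q)⟩ (elemHom y)
        refine ⟨(φ.f p q).hom (freeGen k p q), ?_⟩
        refine Eq.trans ?_ (elemHom_gen y)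
        exact congrArg (fun χ => (Hom.f χ p q).hom (freeGen k p q)) hφ
  · rintro _ ⟨i⟩
    exact isCardinalPresentable_freeOne i.1 i.2

/-! ### Cells and generating (trivial) cofibrations -/

section Cells

variable (k)

/-- The free bicomplex on a generator annihilated by the horizontal differential. -/
noncomputable def hCell (p : ℕ) (q : ℤ) : Bicomplex k :=
  cokernel (elemHom (((freeOne k p q).dh p (p - 1) q).hom (freeGen k p q)))

/-- The generator of `hCell`. -/
noncomputable def hCellGen (p : ℕ) (q : ℤ) : (hCell k p q).X p q :=
  (Hom.f (cokernel.π (elemHom (((freeOne k p q).dh p (p - 1) q).hom (freeGen k p q)))) p q).hom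
    (freeGen k p q)

/-- The free bicomplex on a generator annihilated by the vertical differential. -/
noncomputable def vCell (p : ℕ) (q : ℤ) : Bicomplex k :=
  cokernel (elemHom (((freeOne k p q).dv p q (q - 1)).hom (freeGen k p q)))

/-- The generator of `vCell`. -/
noncomputable def vCellGen (p : ℕ) (q : ℤ) : (vCell k p q).X p q :=
  (Hom.f (cokernel.π (elemHom (((freeOne k p q).dv p q (q - 1)).hom (freeGen k p q)))) p q).hom
    (freeGen k p q)

/-- The free bicomplex on a generator annihilated by both differentials. -/
noncomputable def hvCell (p : ℕ) (q : ℤ) : Bicomplex k :=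
  cokernel (elemHom (((vCell k p q).dh p (p - 1) q).hom (vCellGen k p q)))

/-- The generator of `hvCell`. -/
noncomputable def hvCellGen (p : ℕ) (q : ℤ) : (hvCell k p q).X p q :=
  (Hom.f (cokernel.π (elemHom (((vCell k p q).dh p (p - 1) q).hom (vCellGen k p q)))) p q).hom
    (vCellGen k p q)

/-- A zero object, as the free bicomplex on a generator equal to zero. -/
noncomputable def zeroCell : Bicomplex k := cokernel (elemHom (freeGen k 0 0))

variable {k}

/-- For `p = 0` the truncated `p - 1` is 0 and `dh 0 0 q` vanishes by shape, so both sides hold and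
`hCell k 0 q` carries no extra relation. -/
lemma forall_dh_eq_zero_iff {A : Bicomplex k} {p : ℕ} {q : ℤ} (x : A.X p q) :
    (∀ j, (A.dh p j q).hom x = 0) ↔ (A.dh p (p - 1) q).hom x = 0 := by
  refine ⟨fun h => h _, fun h j => ?_⟩
  by_cases e : j + 1 = p
  · subst e
    exact h
  · exact A.dh_apply_eq_zero x e

lemma isGenerated_hCell (p : ℕ) (q : ℤ) :
    IsGenerated (hCell k p q) (hCellGen k p q) (fun A x => ∀ j, (A.dh p j q).hom x = 0) :=
  (isGenerated_freeOne p q).quotient (elemHom_gen _)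
    (fun {A} ψ => by rw [forall_dh_eq_zero_iff, comm_h_apply]) (fun _ _ => trivial)

lemma isGenerated_vCell (p : ℕ) (q : ℤ) :
    IsGenerated (vCell k p q) (vCellGen k p q) (fun A x => x ∈ A.vCycles p q) :=
  (isGenerated_freeOne p q).quotient (elemHom_gen _)
    (fun {A} ψ => by rw [← comm_v_apply]; rfl) (fun _ _ => trivial)

lemma isGenerated_hvCell (p : ℕ) (q : ℤ) :
    IsGenerated (hvCell k p q) (hvCellGen k p q)
      (fun A x => x ∈ A.vCycles p q ∧ ∀ j, (A.dh p j q).hom x = 0) :=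
  (isGenerated_vCell p q).quotient (elemHom_gen _)
    (fun {A} ψ => by
      rw [forall_dh_eq_zero_iff, comm_h_apply]
      exact ⟨fun h => h.2, fun h => ⟨(isGenerated_vCell p q).prop ψ, h⟩⟩)
    (fun _ h => h.1)

lemma zeroCell_hom_ext {A : Bicomplex k} (φ ψ : zeroCell k ⟶ A) : φ = ψ := by
  have h := (isGenerated_freeOne (k := k) 0 0).quotient (elemHom_gen (freeGen k 0 0))
    (Q := fun _ x => x = 0) (fun {A} ψ => Iff.rfl) (fun _ _ => trivial)
  exact h.hom_ext ((h.prop φ).trans (h.prop ψ).symm)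

lemma isCardinalPresentable_hCell (p : ℕ) (q : ℤ) :
    IsCardinalPresentable.{u} (hCell k p q) ℵ₀ :=
  isCardinalPresentable_cokernel _ (isCardinalPresentable_freeOne _ _)
    (isCardinalPresentable_freeOne _ _)

lemma isCardinalPresentable_vCell (p : ℕ) (q : ℤ) :
    IsCardinalPresentable.{u} (vCell k p q) ℵ₀ :=
  isCardinalPresentable_cokernel _ (isCardinalPresentable_freeOne _ _)
    (isCardinalPresentable_freeOne _ _)

lemma isCardinalPresentable_hvCell (p : ℕ) (q : ℤ) :
    IsCardinalPresentable.{u} (hvCell k p q) ℵ₀ :=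
  isCardinalPresentable_cokernel _ (isCardinalPresentable_freeOne _ _)
    (isCardinalPresentable_vCell _ _)

lemma isCardinalPresentable_zeroCell : IsCardinalPresentable.{u} (zeroCell k) ℵ₀ :=
  isCardinalPresentable_cokernel _ (isCardinalPresentable_freeOne _ _)
    (isCardinalPresentable_freeOne _ _)

end Cells

section Lifting

variable {A B : Bicomplex.{u} k} {f : A ⟶ B}

lemma hasLiftingProperty_zero_iff {T : Bicomplex.{u} k} {p : ℕ} {q : ℤ} {t : T.X p q}
    {P : ∀ A : Bicomplex k, A.X p q → Prop} (hT : IsGenerated T t P) :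
    HasLiftingProperty (0 : zeroCell k ⟶ T) f ↔
      ∀ y, P B y → ∃ x, P A x ∧ (f.f p q).hom x = y := by
  constructor
  · intro h y hy
    obtain ⟨b, rfl⟩ := hT.exists_hom y hy
    have sq : CommSq (0 : zeroCell k ⟶ A) (0 : zeroCell k ⟶ T) f b := ⟨zeroCell_hom_ext _ _⟩
    refine ⟨(Hom.f sq.lift p q).hom t, hT.prop _, ?_⟩
    exact congrArg (fun χ => (Hom.f χ p q).hom t) sq.fac_right
  · intro h
    refine ⟨fun {a b} sq => ?_⟩
    obtain ⟨x, hx, e⟩ := h _ (hT.prop b)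
    obtain ⟨l, rfl⟩ := hT.exists_hom x hx
    exact ⟨⟨⟨l, zeroCell_hom_ext _ _, hT.hom_ext e⟩⟩⟩

/-- A square is a pair of elements x, y with d_h y = f(x), and a filler is an element x' with d_h x'
= x and f(x') = y. -/
lemma hasLiftingProperty_dh_iff {S T : Bicomplex.{u} k} {p : ℕ} {q : ℤ} {s : S.X p q}
    {t : T.X (p + 1) q} {P : ∀ A : Bicomplex k, A.X p q → Prop}
    {Q : ∀ A : Bicomplex k, A.X (p + 1) q → Prop} (hS : IsGenerated S s P)
    (hT : IsGenerated T t Q) {i : S ⟶ T} (hi : (i.f p q).hom s = (T.dh (p + 1) p q).hom t) :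
    HasLiftingProperty i f ↔ ∀ (x : A.X p q) (y : B.X (p + 1) q), P A x → Q B y →
      (B.dh (p + 1) p q).hom y = (f.f p q).hom x →
        ∃ x', Q A x' ∧ (A.dh (p + 1) p q).hom x' = x ∧ (f.f (p + 1) q).hom x' = y := by
  have hi' {C : Bicomplex k} (φ : T ⟶ C) : ((i ≫ φ).f p q).hom s =
      (C.dh (p + 1) p q).hom ((φ.f (p + 1) q).hom t) := by
    rw [comm_h_apply, ← hi]
    rfl
  constructor
  · intro h x y hx hy e
    obtain ⟨a, rfl⟩ := hS.exists_hom x hx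
    obtain ⟨b, rfl⟩ := hT.exists_hom y hy
    have sq : CommSq a i f b := ⟨hS.hom_ext (by rw [hi', e]; rfl)⟩
    refine ⟨(Hom.f sq.lift (p + 1) q).hom t, hT.prop _, ?_, ?_⟩
    · rw [← hi', sq.fac_left]
    · exact congrArg (fun χ => (Hom.f χ (p + 1) q).hom t) sq.fac_right
  · intro h
    refine ⟨fun {a b} sq => ?_⟩
    obtain ⟨x', hx', e₁, e₂⟩ := h _ _ (hS.prop a) (hT.prop b) (by
      rw [← hi', ← sq.w]
      rfl)
    obtain ⟨l, rfl⟩ := hT.exists_hom x' hx'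
    exact ⟨⟨⟨l, hS.hom_ext (by rw [hi', e₁]), hT.hom_ext e₂⟩⟩⟩

end Lifting

variable (k)

/-- The horizontal boundary inclusion between free bicomplexes. -/
noncomputable def hCellIncl (p : ℕ) (q : ℤ) : hCell k p q ⟶ freeOne k (p + 1) q :=
  ((isGenerated_hCell p q).exists_hom (((freeOne k (p + 1) q).dh (p + 1) p q).hom
    (freeGen k (p + 1) q)) (fun _ => dh_dh_apply _ _ _ _ _ _)).choose

lemma hCellIncl_gen (p : ℕ) (q : ℤ) : ((hCellIncl k p q).f p q).hom (hCellGen k p q) =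
    ((freeOne k (p + 1) q).dh (p + 1) p q).hom (freeGen k (p + 1) q) :=
  ((isGenerated_hCell p q).exists_hom (((freeOne k (p + 1) q).dh (p + 1) p q).hom
    (freeGen k (p + 1) q)) (fun _ => dh_dh_apply _ _ _ _ _ _)).choose_spec

/-- The horizontal boundary inclusion between bicomplexes with trivial vertical differential. -/
noncomputable def hvCellIncl (p : ℕ) (q : ℤ) : hvCell k p q ⟶ vCell k (p + 1) q :=
  ((isGenerated_hvCell p q).exists_hom (((vCell k (p + 1) q).dh (p + 1) p q).hom
    (vCellGen k (p + 1) q)) ⟨dh_mem_vCycles _ _ _ _ _ ((isGenerated_vCell (p + 1) q).prop (𝟙 _)),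
      fun _ => dh_dh_apply _ _ _ _ _ _⟩).choose

lemma hvCellIncl_gen (p : ℕ) (q : ℤ) : ((hvCellIncl k p q).f p q).hom (hvCellGen k p q) =
    ((vCell k (p + 1) q).dh (p + 1) p q).hom (vCellGen k (p + 1) q) :=
  ((isGenerated_hvCell p q).exists_hom (((vCell k (p + 1) q).dh (p + 1) p q).hom
    (vCellGen k (p + 1) q)) ⟨dh_mem_vCycles _ _ _ _ _ ((isGenerated_vCell (p + 1) q).prop (𝟙 _)),
      fun _ => dh_dh_apply _ _ _ _ _ _⟩).choose_spec

/-- The generating cofibrations. -/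
inductive genCof : MorphismProperty (Bicomplex.{u} k)
  | rowZero (q : ℤ) : genCof (0 : zeroCell k ⟶ freeOne k 0 q)
  | row (p : ℕ) (q : ℤ) : genCof (hCellIncl k p q)
  | cyclesZero (q : ℤ) : genCof (0 : zeroCell k ⟶ vCell k 0 q)
  | cycles (p : ℕ) (q : ℤ) : genCof (hvCellIncl k p q)

/-- The generating trivial cofibrations. -/
inductive genTrivCof : MorphismProperty (Bicomplex.{u} k)
  | rowZero (q : ℤ) : genTrivCof (0 : zeroCell k ⟶ freeOne k 0 q)
  | row (p : ℕ) (q : ℤ) : genTrivCof (hCellIncl k p q)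
  | cycles (p : ℕ) (q : ℤ) : genTrivCof (0 : zeroCell k ⟶ vCell k (p + 1) q)

instance : IsSmall.{u} (genCof k) where
  small_toSet := by
    let φ : (ℤ ⊕ ℕ × ℤ) ⊕ (ℤ ⊕ ℕ × ℤ) → (genCof k).toSet
      | .inl (.inl q) => ⟨Arrow.mk _, genCof.rowZero q⟩
      | .inl (.inr ⟨p, q⟩) => ⟨Arrow.mk _, genCof.row p q⟩
      | .inr (.inl q) => ⟨Arrow.mk _, genCof.cyclesZero q⟩
      | .inr (.inr ⟨p, q⟩) => ⟨Arrow.mk _, genCof.cycles p q⟩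
    refine small_of_surjective (f := φ) ?_
    rintro ⟨⟨_, _, f⟩, hf⟩
    cases hf with
    | rowZero q => exact ⟨.inl (.inl q), rfl⟩
    | row p q => exact ⟨.inl (.inr (p, q)), rfl⟩
    | cyclesZero q => exact ⟨.inr (.inl q), rfl⟩
    | cycles p q => exact ⟨.inr (.inr (p, q)), rfl⟩

instance : IsSmall.{u} (genTrivCof k) where
  small_toSet := by
    let φ : (ℤ ⊕ ℕ × ℤ) ⊕ (ℕ × ℤ) → (genTrivCof k).toSet
      | .inl (.inl q) => ⟨Arrow.mk _, genTrivCof.rowZero q⟩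
      | .inl (.inr ⟨p, q⟩) => ⟨Arrow.mk _, genTrivCof.row p q⟩
      | .inr ⟨p, q⟩ => ⟨Arrow.mk _, genTrivCof.cycles p q⟩
    refine small_of_surjective (f := φ) ?_
    rintro ⟨⟨_, _, f⟩, hf⟩
    cases hf with
    | rowZero q => exact ⟨.inl (.inl q), rfl⟩
    | row p q => exact ⟨.inl (.inr (p, q)), rfl⟩
    | cycles p q => exact ⟨.inr (p, q), rfl⟩

instance : HasSmallObjectArgument.{u} (genCof k) :=
  hasSmallObjectArgument_of_presentable _ fun i hi => by
    cases hi
    · exact isCardinalPresentable_zeroCell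
    · exact isCardinalPresentable_hCell _ _
    · exact isCardinalPresentable_zeroCell
    · exact isCardinalPresentable_hvCell _ _

instance : HasSmallObjectArgument.{u} (genTrivCof k) :=
  hasSmallObjectArgument_of_presentable _ fun i hi => by
    cases hi
    · exact isCardinalPresentable_zeroCell
    · exact isCardinalPresentable_hCell _ _
    · exact isCardinalPresentable_zeroCell

variable {k} {A B : Bicomplex.{u} k} {f : A ⟶ B}

lemma rowLift_iff_hasLiftingProperty : RowLift f ↔
    (∀ q, HasLiftingProperty (0 : zeroCell k ⟶ freeOne k 0 q) f) ∧
      ∀ p q, HasLiftingProperty (hCellIncl k p q) f := by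
  simp only [hasLiftingProperty_zero_iff (isGenerated_freeOne _ _),
    fun p q => hasLiftingProperty_dh_iff (f := f) (isGenerated_hCell p q)
      (isGenerated_freeOne (p + 1) q) (hCellIncl_gen k p q)]
  exact ⟨fun h => ⟨fun q y _ => (h.zero q y).imp fun _ e => ⟨trivial, e⟩,
      fun p q x y hx _ e => (h.succ p q x y hx e).imp fun _ e => ⟨trivial, e⟩⟩,
    fun h => ⟨fun q y => (h.1 q y trivial).imp fun _ e => e.2,
      fun p q x y hx e => (h.2 p q x y hx trivial e).imp fun _ e => e.2⟩⟩

lemma cyclesLift_iff_hasLiftingProperty : CyclesLift f ↔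
    (∀ q, HasLiftingProperty (0 : zeroCell k ⟶ vCell k 0 q) f) ∧
      ∀ p q, HasLiftingProperty (hvCellIncl k p q) f := by
  simp only [hasLiftingProperty_zero_iff (isGenerated_vCell _ _),
    fun p q => hasLiftingProperty_dh_iff (f := f) (isGenerated_hvCell p q)
      (isGenerated_vCell (p + 1) q) (hvCellIncl_gen k p q)]
  exact ⟨fun h => ⟨h.zero, fun p q x y hx hy e => h.succ p q x y hx.1 hy hx.2 e⟩,
    fun h => ⟨h.1, fun p q x y hx hy hx' e => h.2 p q x y ⟨hx, hx'⟩ hy e⟩⟩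

lemma cyclesSurjective_iff_hasLiftingProperty : CyclesSurjective f ↔
    ∀ p q, HasLiftingProperty (0 : zeroCell k ⟶ vCell k (p + 1) q) f := by
  simp only [hasLiftingProperty_zero_iff (isGenerated_vCell _ _)]
  rfl

lemma genCof_rlp_iff : (genCof k).rlp f ↔ RowLift f ∧ CyclesLift f := by
  rw [rowLift_iff_hasLiftingProperty, cyclesLift_iff_hasLiftingProperty]
  constructor
  · exact fun h => ⟨⟨fun q => h _ (.rowZero q), fun p q => h _ (.row p q)⟩,
      ⟨fun q => h _ (.cyclesZero q), fun p q => h _ (.cycles p q)⟩⟩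
  · rintro ⟨⟨h₁, h₂⟩, h₃, h₄⟩ _ _ _ hi
    cases hi
    exacts [h₁ _, h₂ _ _, h₃ _, h₄ _ _]

lemma genTrivCof_rlp_iff : (genTrivCof k).rlp f ↔ RowLift f ∧ CyclesSurjective f := by
  rw [rowLift_iff_hasLiftingProperty, cyclesSurjective_iff_hasLiftingProperty]
  constructor
  · exact fun h => ⟨⟨fun q => h _ (.rowZero q), fun p q => h _ (.row p q)⟩,
      fun p q => h _ (.cycles p q)⟩
  · rintro ⟨⟨h₁, h₂⟩, h₃⟩ _ _ _ hi
    cases hi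
    exacts [h₁ _, h₂ _ _, h₃ _ _]

end Bicomplex

/-! ### Cofree bicomplexes, right adjoint to forgetting the horizontal differential -/

namespace Bicomplex

variable {k : Type u} [CommRing k]

section Cofree

/-- The bigraded module shifted by one in the horizontal direction. -/
def prev (X : ℕ → ℤ → ModuleCat.{u} k) : ℕ → ℤ → ModuleCat.{u} k
  | 0, _ => ModuleCat.of k PUnit.{u + 1}
  | p + 1, q => X p q

variable {X Y : ℕ → ℤ → ModuleCat.{u} k}

/-- The shift of a family of linear maps. -/
def prevMap {q q' : ℤ} (g : ∀ p, X p q →ₗ[k] Y p q') : ∀ p, prev X p q →ₗ[k] prev Y p q'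
  | 0 => 0
  | p + 1 => g p

lemma prevMap_prevMap {Z : ℕ → ℤ → ModuleCat.{u} k} {q q' q'' : ℤ}
    (g : ∀ p, X p q →ₗ[k] Y p q') (g' : ∀ p, Y p q' →ₗ[k] Z p q'')
    (g'' : ∀ p, X p q →ₗ[k] Z p q'') (h : ∀ p x, g' p (g p x) = g'' p x) :
    ∀ p x, prevMap g' p (prevMap g p x) = prevMap g'' p x
  | 0, _ => rfl
  | p + 1, x => h p x

lemma prevMap_zero {q q' : ℤ} : ∀ (p : ℕ) (x : prev X p q),
    prevMap (fun p => (0 : X p q →ₗ[k] Y p q')) p x = 0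
  | 0, _ => rfl
  | _ + 1, _ => rfl

variable (v : ∀ p q, X p (q + 1) →ₗ[k] X p q) (vv : ∀ p q x, v p q (v p (q + 1) x) = 0)
  (w : ∀ p q, Y p (q + 1) →ₗ[k] Y p q) (ww : ∀ p q x, w p q (w p (q + 1) x) = 0)

/-- The bicomplex cofreely generated by a family of vertical complexes. -/
def cofree : Bicomplex k :=
  ofSucc (fun p q => ModuleCat.of k (X p q × prev X p q))
    (fun p q => ModuleCat.ofHom
      (LinearMap.prod (LinearMap.snd k (X (p + 1) q) (X p q)) 0))
    (fun p q => ModuleCat.ofHom (LinearMap.prodMap (v p q) (- prevMap (fun p => v p q) p)))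
    (fun p q => by
      refine ModuleCat.hom_ext (LinearMap.ext fun x => ?_)
      rfl)
    (fun p q => by
      refine ModuleCat.hom_ext (LinearMap.ext fun x => Prod.ext (vv _ _ _) ?_)
      change - prevMap (fun p => v p q) p (- prevMap (fun p => v p (q + 1)) p x.2) = 0
      rw [map_neg, neg_neg, prevMap_prevMap _ _ (fun _ => 0) (fun p x => vv p q x), prevMap_zero])
    (fun p q => by
      refine ModuleCat.hom_ext (LinearMap.ext fun x => Prod.ext ?_ ?_)
      · exact add_neg_cancel (v p q x.2)
      · change - prevMap (fun p => v p q) p 0 + 0 = 0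
        rw [map_zero, neg_zero, add_zero])

variable {v}

/-- An element of a cofree bicomplex given by its two components. -/
def cofreeMk {p : ℕ} {q : ℤ} (a : X p q) (b : prev X p q) : (cofree v vv).X p q := (a, b)

/-- The first component as a linear map. -/
def cofreeFst (p : ℕ) (q : ℤ) : (cofree v vv).X p q →ₗ[k] X p q :=
  LinearMap.fst k (X p q) (prev X p q)

lemma cofreeMk_eq_zero_iff {p : ℕ} {q : ℤ} {a : X p q} {b : prev X p q} :
    cofreeMk vv a b = 0 ↔ a = 0 ∧ b = 0 := Prod.ext_iff

lemma cofreeMk_eq_iff {p : ℕ} {q : ℤ} {a a' : X p q} {b b' : prev X p q} :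
    cofreeMk vv a b = cofreeMk vv a' b' ↔ a = a' ∧ b = b' := Prod.ext_iff

lemma cofree_dh {p : ℕ} {q : ℤ} (a : X (p + 1) q) (b : X p q) :
    ((cofree v vv).dh (p + 1) p q).hom (cofreeMk vv a b) = cofreeMk vv b 0 :=
  ofSucc_dh_apply _ _ _ _ _ _ _ _ _

lemma cofree_dv {p : ℕ} {q : ℤ} (a : X p (q + 1)) (b : prev X p (q + 1)) :
    ((cofree v vv).dv p (q + 1) q).hom (cofreeMk vv a b) =
      cofreeMk vv (v p q a) (- prevMap (fun p => v p q) p b) :=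
  ofSucc_dv_apply _ _ _ _ _ _ _ _ _

lemma cofreeFst_dv {p : ℕ} {q : ℤ} (x : (cofree v vv).X p (q + 1)) :
    cofreeFst vv p q (((cofree v vv).dv p (q + 1) q).hom x) =
      v p q (cofreeFst vv p (q + 1) x) :=
  congrArg Prod.fst (cofree_dv vv x.1 x.2)

lemma cofreeMk_mem_vCycles {p : ℕ} {q : ℤ} {a : X p (q + 1)} {b : prev X p (q + 1)} :
    cofreeMk vv a b ∈ (cofree v vv).vCycles p (q + 1) ↔
      v p q a = 0 ∧ prevMap (fun p => v p q) p b = 0 := by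
  rw [mem_vCycles_succ, cofree_dv, cofreeMk_eq_zero_iff, neg_eq_zero]

lemma eq_zero_of_cofree_dh {p : ℕ} {q : ℤ} {a : X p q} {b : prev X p q}
    (h : ∀ j, ((cofree v vv).dh p j q).hom (cofreeMk vv a b) = 0) : b = 0 := by
  obtain _ | p := p
  · rfl
  · exact ((cofreeMk_eq_zero_iff vv).1 ((cofree_dh vv a b).symm.trans (h p))).1

variable {w}

/-- The morphism of cofree bicomplexes induced by morphisms of vertical complexes. -/
def cofreeMap (g : ∀ p q, X p q →ₗ[k] Y p q)
    (hg : ∀ p q x, w p q (g p (q + 1) x) = g p q (v p q x)) : cofree v vv ⟶ cofree w ww :=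
  homMkLin (A := cofree v vv) (B := cofree w ww)
    (fun p q => LinearMap.prodMap (g p q) (prevMap (fun p => g p q) p))
    (fun p q x => by
      obtain ⟨a, b⟩ := x
      refine (cofree_dh ww (g (p + 1) q a) (g p q b)).trans (Eq.trans ?_
        (congrArg (LinearMap.prodMap (g p q) (prevMap (fun p => g p q) p))
          (cofree_dh vv a b).symm))
      exact Prod.ext rfl (map_zero (prevMap (fun p => g p q) p)).symm)
    (fun p q x => by
      obtain ⟨a, b⟩ := x
      refine (cofree_dv ww (g p (q + 1) a) (prevMap (fun p => g p (q + 1)) p b)).trans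
        (Eq.trans ?_ (congrArg (LinearMap.prodMap (g p q) (prevMap (fun p => g p q) p))
          (cofree_dv vv a b).symm))
      refine Prod.ext (hg p q a) ?_
      change - prevMap (fun p => w p q) p (prevMap (fun p => g p (q + 1)) p b) =
        prevMap (fun p => g p q) p (- prevMap (fun p => v p q) p b)
      rw [map_neg, prevMap_prevMap _ _ (fun p => g p q ∘ₗ v p q) (fun p x => hg p q x),
        prevMap_prevMap _ _ (fun p => g p q ∘ₗ v p q) (fun _ _ => rfl)])

variable {vv ww}

/-- The rows of a cofree bicomplex are contractible, via (a, b) ↦ (b, 0), so surjectivity alone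
suffices. The vertical cycles form a family of rows of the same shape, which gives the next lemma.
-/
lemma rowLift_cofreeMap (g : ∀ p q, X p q →ₗ[k] Y p q)
    (hg : ∀ p q x, w p q (g p (q + 1) x) = g p q (v p q x))
    (hs : ∀ p q, Function.Surjective (g p q)) : RowLift (cofreeMap vv ww g hg) := by
  refine ⟨fun q => ?_, fun p q => ?_⟩
  · rintro ⟨y₁, y₂⟩
    obtain ⟨x₁, rfl⟩ := hs 0 q y₁
    exact ⟨cofreeMk vv x₁ 0, rfl⟩
  · rintro ⟨x₁, x₂⟩ ⟨y₁, y₂⟩ hx e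
    obtain ⟨x, rfl⟩ := hs (p + 1) q y₁
    have h₂ := eq_zero_of_cofree_dh vv hx
    obtain ⟨e₁, -⟩ := (cofreeMk_eq_iff ww).1 ((cofree_dh ww _ y₂).symm.trans e)
    refine ⟨cofreeMk vv x x₁, (cofree_dh vv x x₁).trans (Prod.ext rfl h₂.symm), ?_⟩
    exact Prod.ext rfl e₁.symm

lemma cyclesLift_cofreeMap (g : ∀ p q, X p q →ₗ[k] Y p q)
    (hg : ∀ p q x, w p q (g p (q + 1) x) = g p q (v p q x))
    (hs : ∀ p q y, w p q y = 0 → ∃ x, v p q x = 0 ∧ g p (q + 1) x = y) :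
    CyclesLift (cofreeMap vv ww g hg) := by
  refine ⟨fun q => ?_, fun p q => ?_⟩
  · obtain ⟨q, rfl⟩ : ∃ r, q = r + 1 := ⟨q - 1, by omega⟩
    rintro ⟨y₁, y₂⟩ hy
    obtain ⟨x₁, hx₁, rfl⟩ := hs 0 q y₁ ((cofreeMk_mem_vCycles ww).1 hy).1
    exact ⟨cofreeMk vv x₁ 0, (cofreeMk_mem_vCycles vv).2 ⟨hx₁, rfl⟩, rfl⟩
  · obtain ⟨q, rfl⟩ : ∃ r, q = r + 1 := ⟨q - 1, by omega⟩
    rintro ⟨x₁, x₂⟩ ⟨y₁, y₂⟩ hx hy hx' e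
    obtain ⟨x, hx'', rfl⟩ := hs (p + 1) q y₁ ((cofreeMk_mem_vCycles ww).1 hy).1
    have h₂ := eq_zero_of_cofree_dh vv hx'
    obtain ⟨e₁, -⟩ := (cofreeMk_eq_iff ww).1 ((cofree_dh ww _ y₂).symm.trans e)
    refine ⟨cofreeMk vv x x₁, (cofreeMk_mem_vCycles vv).2
      ⟨hx'', ((cofreeMk_mem_vCycles vv).1 hx).1⟩,
      (cofree_dh vv x x₁).trans (Prod.ext rfl h₂.symm), ?_⟩
    exact Prod.ext rfl e₁.symm

variable (vv) {A : Bicomplex k}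

/-- The second component of `cofreeLift`. -/
def cofreeLiftSnd (g : ∀ p q, A.X p q →ₗ[k] X p q) : ∀ p q, A.X p q →ₗ[k] prev X p q
  | 0, _ => 0
  | p + 1, q => g p q ∘ₗ (A.dh (p + 1) p q).hom

/-- The morphism to a cofree bicomplex given by morphisms of vertical complexes. -/
def cofreeLift (g : ∀ p q, A.X p q →ₗ[k] X p q)
    (hg : ∀ p q x, v p q (g p (q + 1) x) = g p q ((A.dv p (q + 1) q).hom x)) :
    A ⟶ cofree v vv :=
  homMkLin (B := cofree v vv)
    (fun p q => LinearMap.prod (g p q) (cofreeLiftSnd g p q))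
    (fun p q x => by
      refine (cofree_dh vv _ _).trans (Prod.ext rfl ?_)
      change 0 = cofreeLiftSnd g p q _
      obtain _ | p := p
      · rfl
      · change 0 = g p q _
        rw [dh_dh_apply, map_zero])
    (fun p q x => by
      refine (cofree_dv vv _ _).trans (Prod.ext (hg p q x) ?_)
      change - prevMap (fun p => v p q) p (cofreeLiftSnd g p (q + 1) x) = cofreeLiftSnd g p q _
      obtain _ | p := p
      · rfl
      · change - v p q (g p (q + 1) ((A.dh (p + 1) p (q + 1)).hom x)) =
          g p q ((A.dh (p + 1) p q).hom ((A.dv (p + 1) (q + 1) q).hom x))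
        rw [hg, dv_dh_apply, map_neg, neg_neg])

/-- The second component of the image of x is the first component of the image of d_h x. -/
lemma hom_cofree_ext {φ ψ : A ⟶ cofree v vv}
    (h : ∀ p q x, cofreeFst vv p q ((φ.f p q).hom x) = cofreeFst vv p q ((ψ.f p q).hom x)) :
    φ = ψ := by
  refine hom_ext_apply fun p q x => Prod.ext (h p q x) ?_
  obtain _ | p := p
  · rfl
  · have e (χ : A ⟶ cofree v vv) : ((χ.f (p + 1) q).hom x).2 =
        cofreeFst vv p q ((χ.f p q).hom ((A.dh (p + 1) p q).hom x)) := by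
      rw [← comm_h_apply]
      exact (congrArg Prod.fst (cofree_dh vv ((χ.f (p + 1) q).hom x).1 _)).symm
    rw [e, e, h]

end Cofree

end Bicomplex

/-! ### Vertical splitting of cofibrations -/

/-- The maps `i` and `s` make the cokernel a retract of the projective module `P`. -/
lemma HasProjectiveCokernel.of_factorization {k : Type u} [CommRing k] {M N : ModuleCat.{u} k}
    (g : M ⟶ N) {P : Type u} [AddCommGroup P] [Module k P] [Module.Projective k P]
    (i : N →ₗ[k] P) (s : P →ₗ[k] N) (hi : ∀ m, i (g.hom m) = 0)
    (hs : ∀ n, ∃ m, n = s (i n) + g.hom m) : HasProjectiveCokernel g := by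
  refine Module.Projective.of_split ((LinearMap.range g.hom).liftQ i ?_)
    ((LinearMap.range g.hom).mkQ ∘ₗ s) ?_
  · rintro _ ⟨m, rfl⟩
    exact hi m
  · refine LinearMap.ext fun x => ?_
    obtain ⟨n, rfl⟩ := Submodule.Quotient.mk_surjective _ x
    obtain ⟨m, hm⟩ := hs n
    refine ((Submodule.Quotient.eq (LinearMap.range g.hom)).2 ?_).symm
    exact ⟨m, eq_sub_of_add_eq' hm.symm⟩

namespace Bicomplex

variable {k : Type u} [CommRing k] {A B : Bicomplex.{u} k}

section Cofibration

variable (f : A ⟶ B)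

/-- The sum of a free vertical complex covering the target of `f` and of the source of `f`. -/
noncomputable abbrev Cover (_f : A ⟶ B) (p : ℕ) (q : ℤ) : ModuleCat.{u} k :=
  ModuleCat.of k (((B.vCycles p q →₀ k) × (B.X p q →₀ k) × (B.X p (q + 1) →₀ k)) × A.X p q)

/-- The differential of `Cover f`. -/
noncomputable def coverD (p : ℕ) (q : ℤ) : Cover f p (q + 1) →ₗ[k] Cover f p q :=
  LinearMap.prodMap (LinearMap.prod 0 (LinearMap.prod 0
    (LinearMap.fst k _ _ ∘ₗ LinearMap.snd k _ _))) (A.dv p (q + 1) q).hom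

/-- The projection of `Cover f` onto the target of `f`. -/
noncomputable def coverMap (p : ℕ) (q : ℤ) : Cover f p q →ₗ[k] B.X p q :=
  LinearMap.coprod (LinearMap.coprod (Finsupp.linearCombination k Subtype.val)
    (LinearMap.coprod (Finsupp.linearCombination k id)
      ((B.dv p (q + 1) q).hom ∘ₗ Finsupp.linearCombination k id))) (f.f p q).hom

variable {f}

lemma coverD_apply {p : ℕ} {q : ℤ} (x : Cover f p (q + 1)) :
    coverD f p q x = ((0, 0, x.1.2.1), (A.dv p (q + 1) q).hom x.2) := rfl

lemma coverMap_apply {p : ℕ} {q : ℤ} (z : B.vCycles p q →₀ k) (c : B.X p q →₀ k)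
    (c' : B.X p (q + 1) →₀ k) (a : A.X p q) :
    coverMap f p q ((z, c, c'), a) = Finsupp.linearCombination k Subtype.val z +
      (Finsupp.linearCombination k id c +
        (B.dv p (q + 1) q).hom (Finsupp.linearCombination k id c')) + (f.f p q).hom a := rfl

lemma coverD_coverD {p : ℕ} {q : ℤ} (x : Cover f p (q + 1 + 1)) :
    coverD f p q (coverD f p (q + 1) x) = 0 :=
  Prod.ext rfl (dv_dv_apply _ _ _ _ _ x.2)

lemma linearCombination_mem_vCycles {p : ℕ} {q : ℤ} (z : B.vCycles p q →₀ k) :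
    Finsupp.linearCombination k (Subtype.val : B.vCycles p q → B.X p q) z ∈ B.vCycles p q := by
  have h := Finsupp.apply_linearCombination k (B.vCycles p q).subtype id z
  exact h ▸ Subtype.prop _

lemma dv_coverMap {p : ℕ} {q : ℤ} (x : Cover f p (q + 1)) :
    (B.dv p (q + 1) q).hom (coverMap f p (q + 1) x) = coverMap f p q (coverD f p q x) := by
  obtain ⟨⟨z, c, c'⟩, a⟩ := x
  rw [coverMap_apply, coverD_apply, coverMap_apply]
  simp only [map_add, map_zero, zero_add, dv_dv_apply, add_zero, comm_v_apply,
    mem_vCycles_iff.1 (linearCombination_mem_vCycles z)]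

lemma coverMap_surjective (p : ℕ) (q : ℤ) : Function.Surjective (coverMap f p q) := fun y =>
  ⟨((0, Finsupp.single y 1, 0), 0), by rw [coverMap_apply]; simp⟩

/-- A morphism with the left lifting property with respect to surjective quasi-isomorphisms on rows
and rows of vertical cycles is a retract, as a family of vertical complexes, of the inclusion
into a sum with a free vertical complex. -/
theorem exists_cover_section
    (hf : ∀ {X Y : Bicomplex.{u} k} (g : X ⟶ Y), RowLift g → CyclesLift g →
      HasLiftingProperty f g) :
    ∃ s : ∀ p q, B.X p q →ₗ[k] Cover f p q, (∀ p q a, s p q ((f.f p q).hom a) = (0, a)) ∧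
      (∀ p q b, coverMap f p q (s p q b) = b) ∧
      ∀ p q b, s p q ((B.dv p (q + 1) q).hom b) = coverD f p q (s p (q + 1) b) := by
  -- By adjunction a lift in the square of `i`, `f`, `π`, `j` is a vertical chain map from B to the
  -- cover that extends the inclusion of A and splits the projection.
  let i : A ⟶ cofree (coverD f) fun _ _ => coverD_coverD :=
    cofreeLift _ (fun p q => LinearMap.inr k _ _) fun _ _ _ => rfl
  let π : cofree (coverD f) (fun _ _ => coverD_coverD) ⟶
      cofree (fun p q => (B.dv p (q + 1) q).hom) fun _ _ => dv_dv_apply _ _ _ _ _ :=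
    cofreeMap _ _ (coverMap f) fun _ _ => dv_coverMap
  let j : B ⟶ cofree (fun p q => (B.dv p (q + 1) q).hom) fun _ _ => dv_dv_apply _ _ _ _ _ :=
    cofreeLift _ (fun p q => LinearMap.id) fun _ _ _ => rfl
  -- The summand free on B, paired with its copy one vertical degree lower as a disk, makes the
  -- projection surjective; the summand free on vertical cycles, with zero differential, makes it
  -- surjective on cycles.
  have := hf π (rowLift_cofreeMap _ _ coverMap_surjective)
    (cyclesLift_cofreeMap _ _ fun p q y hy =>
      ⟨((Finsupp.single ⟨y, mem_vCycles_succ.2 hy⟩ 1, 0, 0), 0),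
        Prod.ext rfl (map_zero (A.dv p (q + 1) q).hom), by rw [coverMap_apply]; simp⟩)
  have sq : CommSq i f π j := ⟨hom_cofree_ext _ fun p q a => by
    change coverMap f p q ((0, 0, 0), a) = (f.f p q).hom a
    rw [coverMap_apply]
    simp⟩
  refine ⟨fun p q => cofreeFst _ p q ∘ₗ (Hom.f sq.lift p q).hom, fun p q a => ?_,
    fun p q b => ?_, fun p q b => ?_⟩
  · exact congrArg (fun χ => cofreeFst _ p q ((Hom.f χ p q).hom a)) sq.fac_left
  · exact congrArg (fun χ => cofreeFst _ p q ((Hom.f χ p q).hom b)) sq.fac_right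
  · refine Eq.trans ?_ (cofreeFst_dv _ _)
    exact congrArg (cofreeFst _ p q) (comm_v_apply sq.lift p (q + 1) q b).symm

variable {s : ∀ p q, B.X p q →ₗ[k] Cover f p q}

/-- The A-component of `s` is a retraction of f. It commutes with d_v, so the same argument works on
vertical homology. -/
lemma injective_of_cover (h₁ : ∀ p q a, s p q ((f.f p q).hom a) = (0, a)) (p : ℕ) (q : ℤ) :
    Function.Injective (f.f p q).hom := fun a a' h => by
  have e := congrArg (s p q) h
  rw [h₁, h₁] at e
  exact congrArg Prod.snd e

lemma vHomologyRow_injective_of_cover (h₁ : ∀ p q a, s p q ((f.f p q).hom a) = (0, a))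
    (h₃ : ∀ p q b, s p q ((B.dv p (q + 1) q).hom b) = coverD f p q (s p (q + 1) b))
    (p : ℕ) (q : ℤ) : Function.Injective (((vHomologyRow q).map f).f p).hom := by
  refine (injective_iff_map_eq_zero (((vHomologyRow q).map f).f p).hom).2 fun a ha => ?_
  obtain ⟨x, hx, rfl⟩ := exists_vClass a
  obtain ⟨u, hu⟩ := vHomologyRow_map_eq_zero_iff.1 ha
  refine vClass_eq_zero_iff.2 ⟨(s p (q + 1) u).2, ?_⟩
  have e := h₁ p q x
  rw [hu, h₃] at e
  exact (congrArg Prod.snd e).symm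

/-- Modulo the part coming from A, the boundaries of the cover are the bottoms of the disks, a free
module of which the cokernel is a retract. -/
lemma hasProjectiveCokernel_vBoundariesRow_of_cover
    (h₁ : ∀ p q a, s p q ((f.f p q).hom a) = (0, a))
    (h₂ : ∀ p q b, coverMap f p q (s p q b) = b)
    (h₃ : ∀ p q b, s p q ((B.dv p (q + 1) q).hom b) = coverD f p q (s p (q + 1) b))
    (p : ℕ) (q : ℤ) : HasProjectiveCokernel (((vBoundariesRow q).map f).f p) := by
  refine .of_factorization _ (P := B.X p (q + 1) →₀ k)
    (LinearMap.snd k _ _ ∘ₗ LinearMap.snd k _ _ ∘ₗ LinearMap.fst k _ _ ∘ₗ s p q ∘ₗ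
      (B.vBoundaries p q).subtype)
    ((B.dv p (q + 1) q).hom.rangeRestrict ∘ₗ Finsupp.linearCombination k id) ?_ ?_
  · rintro ⟨x, hx⟩
    exact congrArg (fun w => w.1.2.2) (h₁ p q x)
  · rintro ⟨_, u, rfl⟩
    refine ⟨⟨(A.dv p (q + 1) q).hom (s p (q + 1) u).2, _, rfl⟩, Subtype.ext ?_⟩
    have e := h₂ p q ((B.dv p (q + 1) q).hom u)
    change (B.dv p (q + 1) q).hom u = (B.dv p (q + 1) q).hom (Finsupp.linearCombination k id
      (s p q ((B.dv p (q + 1) q).hom u)).1.2.2) +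
        (f.f p q).hom ((A.dv p (q + 1) q).hom (s p (q + 1) u).2)
    rw [h₃, coverD_apply, coverMap_apply, map_zero, map_zero, zero_add, zero_add] at e
    rw [h₃]
    exact e.symm

/-- The disks have no homology, so modulo A the homology of the cover is the free module on vertical
cycles, and the cokernel is a retract of it. -/
lemma hasProjectiveCokernel_vHomologyRow_of_cover
    (h₁ : ∀ p q a, s p q ((f.f p q).hom a) = (0, a))
    (h₂ : ∀ p q b, coverMap f p q (s p q b) = b)
    (h₃ : ∀ p q b, s p q ((B.dv p (q + 1) q).hom b) = coverD f p q (s p (q + 1) b))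
    (p : ℕ) (q : ℤ) : HasProjectiveCokernel (((vHomologyRow q).map f).f p) := by
  obtain ⟨q, rfl⟩ : ∃ r, q = r + 1 := ⟨q - 1, by omega⟩
  refine .of_factorization _ (P := B.vCycles p (q + 1) →₀ k)
    (((B.vBoundaries p (q + 1)).submoduleOf (B.vCycles p (q + 1))).liftQ
      (LinearMap.fst k _ _ ∘ₗ LinearMap.fst k _ _ ∘ₗ s p (q + 1) ∘ₗ
        (B.vCycles p (q + 1)).subtype) ?_)
    (((B.vBoundaries p (q + 1)).submoduleOf (B.vCycles p (q + 1))).mkQ ∘ₗ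
      Finsupp.linearCombination k id) ?_ ?_
  · rintro ⟨_, hx⟩ ⟨u, rfl⟩
    exact congrArg (fun w => w.1.1) (h₃ p (q + 1) u)
  · intro a
    obtain ⟨x, hx, rfl⟩ := exists_vClass a
    exact congrArg (fun w => w.1.1) (h₁ p (q + 1) x)
  · intro b
    obtain ⟨y, hy, rfl⟩ := exists_vClass b
    have e := h₂ p (q + 1) y
    have e' := h₃ p q y
    rw [mem_vCycles_succ.1 hy, map_zero, coverD_apply] at e'
    -- Since `y` is a vertical cycle, `s y` has no component at the top of a disk, and the bottom
    -- component projects to a boundary.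
    have hc : (s p (q + 1) y).1.2.1 = 0 := (congrArg (fun w => w.1.2.2) e').symm
    have ha : (A.dv p (q + 1) q).hom (s p (q + 1) y).2 = 0 := (congrArg Prod.snd e').symm
    refine ⟨vClass (s p (q + 1) y).2 (mem_vCycles_succ.2 ha), ?_⟩
    refine (Submodule.Quotient.eq _).2 ⟨Finsupp.linearCombination k id (s p (q + 1) y).1.2.2, ?_⟩
    change _ = y - (Subtype.val (Finsupp.linearCombination k id (s p (q + 1) y).1.1) +
      (f.f p (q + 1)).hom (s p (q + 1) y).2)
    have hz := Finsupp.apply_linearCombination k (B.vCycles p (q + 1)).subtype id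
      (s p (q + 1) y).1.1
    have e₃ : coverMap f p (q + 1) (s p (q + 1) y) =
      Finsupp.linearCombination k Subtype.val (s p (q + 1) y).1.1 +
      (Finsupp.linearCombination k id (s p (q + 1) y).1.2.1 +
        (B.dv p (q + 1 + 1) (q + 1)).hom
          (Finsupp.linearCombination k id (s p (q + 1) y).1.2.2)) +
        (f.f p (q + 1)).hom (s p (q + 1) y).2 := rfl
    rw [e, hc, map_zero, zero_add] at e₃
    rw [eq_sub_iff_add_eq]
    refine Eq.trans ?_ e₃.symm
    refine Eq.trans ?_ (congrArg (fun w => w + _ + _) hz)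
    exact (add_left_comm _ _ _).trans (add_assoc _ _ _).symm

end Cofibration

end Bicomplex

/-! ### Lifting against fibrations implies weak equivalence -/

namespace Bicomplex

open ChainLift

variable {k : Type u} [CommRing k]

section Prod

/-- The product of two bicomplexes. -/
def prod (A B : Bicomplex.{u} k) : Bicomplex.{u} k where
  X p q := ModuleCat.of k (A.X p q × B.X p q)
  dh p p' q := ModuleCat.ofHom (LinearMap.prodMap (A.dh p p' q).hom (B.dh p p' q).hom)
  dv p q q' := ModuleCat.ofHom (LinearMap.prodMap (A.dv p q q').hom (B.dv p q q').hom)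
  dh_shape _ _ _ h := ModuleCat.hom_ext <| LinearMap.ext fun x =>
    Prod.ext (A.dh_apply_eq_zero x.1 h) (B.dh_apply_eq_zero x.2 h)
  dv_shape _ _ _ h := ModuleCat.hom_ext <| LinearMap.ext fun x =>
    Prod.ext (A.dv_apply_eq_zero x.1 h) (B.dv_apply_eq_zero x.2 h)
  dh_dh p p' p'' q := ModuleCat.hom_ext <| LinearMap.ext fun x =>
    Prod.ext (A.dh_dh_apply p p' p'' q x.1) (B.dh_dh_apply p p' p'' q x.2)
  dv_dv p q q' q'' := ModuleCat.hom_ext <| LinearMap.ext fun x =>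
    Prod.ext (A.dv_dv_apply p q q' q'' x.1) (B.dv_dv_apply p q q' q'' x.2)
  anticomm p p' q q' := ModuleCat.hom_ext <| LinearMap.ext fun x =>
    Prod.ext (eq_neg_iff_add_eq_zero.1 (A.dv_dh_apply p p' q q' x.1))
      (eq_neg_iff_add_eq_zero.1 (B.dv_dh_apply p p' q q' x.2))

variable {A B C : Bicomplex.{u} k}

/-- The morphism out of a product which is the sum of the given morphisms. -/
def prodDesc (f : A ⟶ C) (g : B ⟶ C) : prod A B ⟶ C :=
  homMkLin (A := prod A B) (fun p q => LinearMap.coprod (f.f p q).hom (g.f p q).hom)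
    (fun p q x => by
      change (C.dh (p + 1) p q).hom ((f.f (p + 1) q).hom x.1 + (g.f (p + 1) q).hom x.2) =
        (f.f p q).hom ((A.dh (p + 1) p q).hom x.1) + (g.f p q).hom ((B.dh (p + 1) p q).hom x.2)
      rw [map_add, comm_h_apply, comm_h_apply])
    (fun p q x => by
      change (C.dv p (q + 1) q).hom ((f.f p (q + 1)).hom x.1 + (g.f p (q + 1)).hom x.2) =
        (f.f p q).hom ((A.dv p (q + 1) q).hom x.1) + (g.f p q).hom ((B.dv p (q + 1) q).hom x.2)
      rw [map_add, comm_v_apply, comm_v_apply])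

/-- A summand with exact rows does not change the row homology: choose a horizontal preimage in B
and correct its image using `f`. -/
lemma rowLift_prodDesc {f : A ⟶ C} (g : B ⟶ C) (hf : RowLift f)
    (hB : ∀ (p : ℕ) (q : ℤ) (x : B.X p q), (∀ j, (B.dh p j q).hom x = 0) →
      ∃ x', (B.dh (p + 1) p q).hom x' = x) : RowLift (prodDesc f g) := by
  refine ⟨fun q y => ?_, ?_⟩
  · obtain ⟨x, rfl⟩ := hf.zero q y
    exact ⟨(x, 0), (congrArg _ (map_zero (g.f 0 q).hom)).trans (add_zero _)⟩
  · rintro p q ⟨a, b⟩ y h e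
    obtain ⟨b, rfl⟩ := hB p q b fun j => congrArg Prod.snd (h j)
    obtain ⟨a', h₁, h₂⟩ := hf.succ p q a (y - (g.f (p + 1) q).hom b)
      (fun j => congrArg Prod.fst (h j)) (by
        rw [map_sub, comm_h_apply, sub_eq_iff_eq_add]
        exact e)
    exact ⟨(a', b), Prod.ext h₁ rfl, (congrArg (· + _) h₂).trans (sub_add_cancel _ _)⟩

lemma cyclesSurjective_prodDesc (f : A ⟶ C) {g : B ⟶ C} (hg : CyclesSurjective g) :
    CyclesSurjective (prodDesc f g) := fun p q y hy => by
  obtain ⟨x, hx, rfl⟩ := hg p q y hy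
  exact ⟨(0, x), Prod.ext (map_zero (A.dv (p + 1) q (q - 1)).hom) hx,
    (congrArg (· + _) (map_zero (f.f (p + 1) q).hom)).trans (zero_add _)⟩

end Prod

section Quotient

variable {A B : Bicomplex.{u} k} (f : A ⟶ B)

/-- The quotient of a bicomplex by the image of a morphism. -/
def quotient : Bicomplex.{u} k where
  X p q := ModuleCat.of k (B.X p q ⧸ LinearMap.range (f.f p q).hom)
  dh p p' q := ModuleCat.ofHom (Submodule.mapQ _ _ (B.dh p p' q).hom (by
    rintro _ ⟨a, rfl⟩
    exact ⟨_, (comm_h_apply f p p' q a).symm⟩))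
  dv p q q' := ModuleCat.ofHom (Submodule.mapQ _ _ (B.dv p q q').hom (by
    rintro _ ⟨a, rfl⟩
    exact ⟨_, (comm_v_apply f p q q' a).symm⟩))
  dh_shape _ _ _ h := ModuleCat.hom_ext <| Submodule.linearMap_qext _ <| LinearMap.ext fun x =>
    congrArg (Submodule.mkQ _) (B.dh_apply_eq_zero x h)
  dv_shape _ _ _ h := ModuleCat.hom_ext <| Submodule.linearMap_qext _ <| LinearMap.ext fun x =>
    congrArg (Submodule.mkQ _) (B.dv_apply_eq_zero x h)
  dh_dh p p' p'' q := ModuleCat.hom_ext <| Submodule.linearMap_qext _ <| LinearMap.ext fun x =>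
    congrArg (Submodule.mkQ _) (B.dh_dh_apply p p' p'' q x)
  dv_dv p q q' q'' := ModuleCat.hom_ext <| Submodule.linearMap_qext _ <| LinearMap.ext fun x =>
    congrArg (Submodule.mkQ _) (B.dv_dv_apply p q q' q'' x)
  anticomm p p' q q' := ModuleCat.hom_ext <| Submodule.linearMap_qext _ <| LinearMap.ext fun x =>
    congrArg (Submodule.mkQ _) (eq_neg_iff_add_eq_zero.1 (B.dv_dh_apply p p' q q' x))

/-- The projection to the quotient. -/
def quotientπ : B ⟶ quotient f where
  f _ _ := ModuleCat.ofHom (Submodule.mkQ _)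
  comm_h _ _ _ := rfl
  comm_v _ _ _ := rfl

lemma quotientπ_surjective (p : ℕ) (q : ℤ) :
    Function.Surjective ((quotientπ f).f p q).hom := Submodule.mkQ_surjective _

variable {f}

lemma quotientπ_eq_iff {p : ℕ} {q : ℤ} {x y : B.X p q} :
    ((quotientπ f).f p q).hom x = ((quotientπ f).f p q).hom y ↔
      ∃ a, x = y + (f.f p q).hom a := by
  refine (Submodule.Quotient.eq _).trans ?_
  change (∃ a, (f.f p q).hom a = x - y) ↔ _
  exact exists_congr fun u => by rw [eq_sub_iff_add_eq, add_comm, eq_comm]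

lemma quotientπ_map_eq_zero {p : ℕ} {q : ℤ} (a : A.X p q) :
    ((quotientπ f).f p q).hom ((f.f p q).hom a) = 0 :=
  (quotientπ_eq_iff.2 ⟨a, (zero_add _).symm⟩).trans (map_zero _)

end Quotient

section Staircase

variable (C : Bicomplex.{u} k)

/-- The sum of the modules `C.X i j` with `i + j = p + q` and `i ≤ p`. -/
def stair : ℕ → ℤ → ModuleCat.{u} k
  | 0, q => C.X 0 q
  | p + 1, q => ModuleCat.of k (C.X (p + 1) q × stair p (q + 1))

/-- The projection to the component of highest horizontal degree. -/
def stairTop : ∀ p q, stair C p q →ₗ[k] C.X p q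
  | 0, _ => LinearMap.id
  | p + 1, q => LinearMap.fst k (C.X (p + 1) q) (stair C p (q + 1))

/-- The total differential, truncated. -/
def stairD : ∀ p q, stair C (p + 1) q →ₗ[k] stair C p q
  | 0, q => LinearMap.coprod (C.dh 1 0 q).hom (C.dv 0 (q + 1) q).hom
  | p + 1, q => LinearMap.prod
      (LinearMap.coprod (C.dh (p + 2) (p + 1) q).hom
        ((C.dv (p + 1) (q + 1) q).hom ∘ₗ stairTop C (p + 1) (q + 1)))
      (stairD p (q + 1) ∘ₗ LinearMap.snd k (C.X (p + 2) q) (stair C (p + 1) (q + 1)))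

variable {C}

lemma stairTop_stairD : ∀ (p : ℕ) (q : ℤ) (c : C.X (p + 1) q) (s : stair C p (q + 1)),
    stairTop C p q (stairD C p q (c, s)) =
      (C.dh (p + 1) p q).hom c + (C.dv p (q + 1) q).hom (stairTop C p (q + 1) s)
  | 0, _, _, _ => rfl
  | _ + 1, _, _, _ => rfl

lemma stairD_succ (p : ℕ) (q : ℤ) (x : stair C (p + 2) q) :
    (stairD C (p + 1) q x).2 = stairD C p (q + 1) x.2 := rfl

lemma stair_ext {p : ℕ} {q : ℤ} {x y : stair C (p + 1) q}
    (h₁ : stairTop C (p + 1) q x = stairTop C (p + 1) q y) (h₂ : x.2 = y.2) : x = y :=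
  Prod.ext h₁ h₂

lemma dv_stairTop_stairD (p : ℕ) (q : ℤ) (s : stair C (p + 1) (q + 1)) :
    (C.dv p (q + 1) q).hom (stairTop C p (q + 1) (stairD C p (q + 1) s)) =
      - (C.dh (p + 1) p q).hom ((C.dv (p + 1) (q + 1) q).hom (stairTop C (p + 1) (q + 1) s)) := by
  obtain ⟨c, s⟩ := s
  rw [stairTop_stairD, map_add, dv_dv_apply, add_zero, dv_dh_apply]
  rfl

lemma stairTop_stairD_stairD (p : ℕ) (q : ℤ) (x : stair C (p + 2) q) :
    stairTop C p q (stairD C p q (stairD C (p + 1) q x)) = 0 := by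
  obtain ⟨c, s⟩ := x
  refine (stairTop_stairD p q _ (stairD C p (q + 1) s)).trans ?_
  rw [dv_stairTop_stairD, ← sub_eq_add_neg, ← map_sub]
  refine Eq.trans ?_ (C.dh_dh_apply (p + 2) (p + 1) p q c)
  exact congrArg _ (add_sub_cancel_right _ _)

/-- The tail of the differential is the differential of the tail, so only the top component has to
be checked, where the usual cancellation in a total complex takes place. -/
lemma stairD_stairD : ∀ (p : ℕ) (q : ℤ) (x : stair C (p + 2) q),
    stairD C p q (stairD C (p + 1) q x) = 0
  | 0, q, x => stairTop_stairD_stairD 0 q x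
  | p + 1, q, x => stair_ext ((stairTop_stairD_stairD (p + 1) q x).trans (map_zero _).symm)
      (stairD_stairD p (q + 1) x.2)

variable (C)

/-- A bicomplex with contractible columns which surjects onto `C` and whose rows are
quasi-isomorphic to those of `C`. -/
def cone : Bicomplex.{u} k :=
  ofSucc (fun p q => ModuleCat.of k (stair C p q × stair C p (q + 1)))
    (fun p q => ModuleCat.ofHom (LinearMap.prod (stairD C p q ∘ₗ LinearMap.fst k _ _)
      (- (LinearMap.snd k (C.X (p + 1) q) (stair C p (q + 1)) ∘ₗ LinearMap.fst k _ _)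
        - stairD C p (q + 1) ∘ₗ LinearMap.snd k _ _)))
    (fun p q => ModuleCat.ofHom (LinearMap.prod 0
      (LinearMap.fst k (stair C p (q + 1)) (stair C p (q + 1 + 1)))))
    (fun p q => by
      refine ModuleCat.hom_ext (LinearMap.ext fun x => Prod.ext (stairD_stairD p q x.1) ?_)
      change - (stairD C (p + 1) q x.1).2 - stairD C p (q + 1)
        (- x.1.2 - stairD C (p + 1) (q + 1) x.2) = 0
      rw [map_sub, stairD_stairD, map_neg, sub_zero, stairD_succ, neg_sub_neg, sub_self])
    (fun p q => ModuleCat.hom_ext (LinearMap.ext fun x => rfl))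
    (fun p q => by
      refine ModuleCat.hom_ext (LinearMap.ext fun x => Prod.ext ?_ ?_)
      · change 0 + stairD C p q 0 = 0
        rw [map_zero, add_zero]
      · change stairD C p (q + 1) x.1 + (- 0 - stairD C p (q + 1) x.1) = 0
        rw [neg_zero, zero_sub, add_neg_cancel])

variable {C}

lemma cone_dh {p : ℕ} {q : ℤ} (a : stair C (p + 1) q) (b : stair C (p + 1) (q + 1)) :
    ((cone C).dh (p + 1) p q).hom (a, b) =
      (stairD C p q a, - a.2 - stairD C p (q + 1) b) :=
  ofSucc_dh_apply _ _ _ _ _ _ _ _ _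

lemma cone_dv {p : ℕ} {q : ℤ} (a : stair C p (q + 1)) (b : stair C p (q + 1 + 1)) :
    ((cone C).dv p (q + 1) q).hom (a, b) = (0, a) :=
  ofSucc_dv_apply _ _ _ _ _ _ _ _ _

variable (C)

/-- The projection from `cone C` to `C`. -/
def coneπ : cone C ⟶ C :=
  homMkLin (A := cone C)
    (fun p q => LinearMap.coprod (stairTop C p q)
      ((C.dv p (q + 1) q).hom ∘ₗ stairTop C p (q + 1)))
    (fun p q x => by
      obtain ⟨⟨c, s⟩, b⟩ := x
      refine Eq.trans ?_ (congrArg (LinearMap.coprod (stairTop C p q)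
        ((C.dv p (q + 1) q).hom ∘ₗ stairTop C p (q + 1))) (cone_dh (c, s) b)).symm
      change (C.dh (p + 1) p q).hom (c + (C.dv (p + 1) (q + 1) q).hom
        (stairTop C (p + 1) (q + 1) b)) = stairTop C p q (stairD C p q (c, s)) +
          (C.dv p (q + 1) q).hom (stairTop C p (q + 1) (- s - stairD C p (q + 1) b))
      rw [stairTop_stairD, map_add, map_sub, map_sub, dv_stairTop_stairD, map_neg, map_neg]
      abel)
    (fun p q x => by
      obtain ⟨a, b⟩ := x
      refine Eq.trans ?_ (congrArg (LinearMap.coprod (stairTop C p q)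
        ((C.dv p (q + 1) q).hom ∘ₗ stairTop C p (q + 1))) (cone_dv a b)).symm
      change (C.dv p (q + 1) q).hom (stairTop C p (q + 1) a +
        (C.dv p (q + 1 + 1) (q + 1)).hom (stairTop C p (q + 1 + 1) b)) =
          stairTop C p q 0 + (C.dv p (q + 1) q).hom (stairTop C p (q + 1) a)
      rw [map_add, dv_dv_apply, add_zero, map_zero, zero_add])

/-- Row q of the cone is the homotopy fibre of the map that drops the top component, from the stairs
of row q to the shifted stairs of row q + 1. That map is surjective with kernel the row of C, so the
row of the cone is quasi-isomorphic to it. -/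
lemma rowLift_coneπ : RowLift (coneπ C) := by
  refine ⟨fun q y => ⟨((y : stair C 0 q), (0 : stair C 0 (q + 1))), ?_⟩, ?_⟩
  · exact (congrArg (y + ·) (map_zero (C.dv 0 (q + 1) q).hom)).trans (add_zero y)
  · rintro p q ⟨a, b⟩ y h e
    change (C.dh (p + 1) p q).hom y = stairTop C p q a +
      (C.dv p (q + 1) q).hom (stairTop C p (q + 1) b) at e
    have ha : stairD C p q (y, - b) = a := by
      have ht : stairTop C p q (stairD C p q (y, - b)) = stairTop C p q a := by
        rw [stairTop_stairD, e, map_neg, map_neg, add_neg_cancel_right]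
      obtain _ | p := p
      · exact ht
      · refine stair_ext ht ?_
        have h' := congrArg Prod.snd ((cone_dh a b).symm.trans (h p))
        change - a.2 - stairD C p (q + 1) b = 0 at h'
        change stairD C p (q + 1) (- b) = a.2
        rw [map_neg, ← sub_eq_zero, ← h']
        abel
    -- The top component is forced by the projection to C; the tail `-b` makes the second component
    -- of d_h equal to `b`.
    refine ⟨((y, - b), (0 : stair C (p + 1) (q + 1))), ?_, ?_⟩
    · refine (cone_dh _ _).trans (Prod.ext ha ?_)
      change - - b - stairD C p (q + 1) 0 = b
      rw [map_zero, sub_zero, neg_neg]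
    · change y + (C.dv (p + 1) (q + 1) q).hom (stairTop C (p + 1) (q + 1) 0) = y
      rw [map_zero, map_zero, add_zero]

lemma exists_dv_eq_of_mem_vCycles_cone {p : ℕ} {q : ℤ} (x : (cone C).X p q)
    (hx : x ∈ (cone C).vCycles p q) : ∃ u, ((cone C).dv p (q + 1) q).hom u = x := by
  obtain ⟨q, rfl⟩ : ∃ r, q = r + 1 := ⟨q - 1, by omega⟩
  obtain ⟨a, b⟩ := x
  have ha : a = 0 := congrArg Prod.snd ((cone_dv a b).symm.trans (mem_vCycles_succ.1 hx))
  exact ⟨(b, (0 : stair C p (q + 1 + 1 + 1))), (cone_dv _ _).trans (Prod.ext ha.symm rfl)⟩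

end Staircase

section Path

variable (C : Bicomplex.{u} k)

/-- The bicomplex cofreely generated by the vertical cycles of `C` in positive horizontal degrees,
with trivial vertical differential. -/
def path : Bicomplex.{u} k :=
  cofree (X := fun p q => ModuleCat.of k (C.vCycles (p + 1) q)) (fun _ _ => 0) fun _ _ _ => rfl

variable {C}

lemma path_dh {p : ℕ} {q : ℤ} (a : C.vCycles (p + 1 + 1) q) (b : C.vCycles (p + 1) q) :
    ((path C).dh (p + 1) p q).hom (a, b) =
      (b, (0 : prev (fun p q => ModuleCat.of k (C.vCycles (p + 1) q)) p q)) :=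
  cofree_dh (X := fun p q => ModuleCat.of k (C.vCycles (p + 1) q)) _ a b

lemma path_dv {p : ℕ} {q q' : ℤ} (x : (path C).X p q) : ((path C).dv p q q').hom x = 0 := by
  by_cases e : q' + 1 = q
  · subst e
    refine (cofree_dv (X := fun p q => ModuleCat.of k (C.vCycles (p + 1) q)) _ x.1 x.2).trans
      (Prod.ext rfl ?_)
    exact neg_eq_zero.2 (prevMap_zero p x.2)
  · exact dv_apply_eq_zero _ x e

lemma exists_dh_eq_path {p : ℕ} {q : ℤ} (x : (path C).X p q)
    (h : ∀ j, ((path C).dh p j q).hom x = 0) : ∃ y, ((path C).dh (p + 1) p q).hom y = x := by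
  obtain ⟨a, b⟩ := x
  have hb := eq_zero_of_cofree_dh _ h
  exact ⟨((0 : C.vCycles (p + 1 + 1) q), a), (path_dh _ _).trans (Prod.ext rfl hb.symm)⟩

variable (C)

/-- The inclusion of the vertical cycles in positive horizontal degrees. -/
def prevVal : ∀ p q, prev (fun p q => ModuleCat.of k (C.vCycles (p + 1) q)) p q →ₗ[k] C.X p q
  | 0, _ => 0
  | p + 1, q => (C.vCycles (p + 1) q).subtype

/-- The canonical morphism from `path C` to `C`. -/
def pathπ : path C ⟶ C :=
  homMkLin (A := path C)
    (fun p q => LinearMap.coprod ((C.dh (p + 1) p q).hom ∘ₗ (C.vCycles (p + 1) q).subtype)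
      (prevVal C p q))
    (fun p q x => by
      obtain ⟨a, b⟩ := x
      refine Eq.trans ?_ (congrArg (LinearMap.coprod ((C.dh (p + 1) p q).hom ∘ₗ
        (C.vCycles (p + 1) q).subtype) (prevVal C p q)) (path_dh a b)).symm
      change (C.dh (p + 1) p q).hom ((C.dh (p + 2) (p + 1) q).hom a.1 + b.1) =
        (C.dh (p + 1) p q).hom b.1 + prevVal C p q 0
      rw [map_add, dh_dh_apply, zero_add, map_zero, add_zero])
    (fun p q x => by
      refine Eq.trans ?_ ((congrArg (LinearMap.coprod ((C.dh (p + 1) p q).hom ∘ₗ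
        (C.vCycles (p + 1) q).subtype) (prevVal C p q)) (path_dv x)).trans (map_zero _)).symm
      obtain ⟨a, b⟩ := x
      refine mem_vCycles_succ.1 (add_mem (dh_mem_vCycles _ _ _ _ _ a.2) ?_)
      obtain _ | p := p
      · exact Submodule.zero_mem _
      · exact b.2)

lemma cyclesSurjective_pathπ : CyclesSurjective (pathπ C) := fun p q y hy => by
  refine ⟨((0 : C.vCycles (p + 2) q), (⟨y, hy⟩ : C.vCycles (p + 1) q)), path_dv _, ?_⟩
  exact (congrArg (· + y) (map_zero (C.dh (p + 2) (p + 1) q).hom)).trans (zero_add y)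

end Path

section Acyclicity

variable {A B : Bicomplex.{u} k} {f : A ⟶ B}

/-- The relative cycles in the target of a morphism having the left lifting property with respect
to fibrations are boundaries. -/
lemma exists_eq_dv_add_dh_of_llp
    (hf : ∀ {X Y : Bicomplex.{u} k} (g : X ⟶ Y), RowLift g → CyclesSurjective g →
      HasLiftingProperty f g) {p : ℕ} {q : ℤ} (b : B.X p q)
    (hv : ∀ q', (B.dv p q q').hom b ∈ LinearMap.range (f.f p q').hom)
    (hh : ∀ j, ∃ u a, (B.dh p j q).hom b = (B.dv j (q + 1) q).hom u + (f.f j q).hom a) :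
    ∃ u w a, b = (B.dv p (q + 1) q).hom u + (B.dh (p + 1) p q).hom w + (f.f p q).hom a ∧
      ∀ q', (B.dv (p + 1) q q').hom w ∈ LinearMap.range (f.f (p + 1) q').hom := by
  -- The cone provides the condition on rows, the path object surjectivity on vertical cycles;
  -- together they form a fibration onto the cokernel.
  let g := prodDesc (coneπ (quotient f)) (pathπ (quotient f))
  have := hf g (rowLift_prodDesc _ (rowLift_coneπ _) fun p q x hx => exists_dh_eq_path x hx)
    (cyclesSurjective_prodDesc _ (cyclesSurjective_pathπ _))
  have sq : CommSq (0 : A ⟶ prod (cone (quotient f)) (path (quotient f))) f g (quotientπ f) :=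
    ⟨hom_ext_apply fun p q a => (map_zero (g.f p q).hom).trans (quotientπ_map_eq_zero a).symm⟩
  have h₀ (p : ℕ) (q : ℤ) (a : A.X p q) : (Hom.f sq.lift p q).hom ((f.f p q).hom a) = 0 :=
    congrArg (fun χ => (Hom.f χ p q).hom a) sq.fac_left
  have hg (p : ℕ) (q : ℤ) (b : B.X p q) :
      (g.f p q).hom ((Hom.f sq.lift p q).hom b) = ((quotientπ f).f p q).hom b :=
    congrArg (fun χ => (Hom.f χ p q).hom b) sq.fac_right
  obtain ⟨x, hx⟩ : ∃ x, x = (Hom.f sq.lift p q).hom b := ⟨_, rfl⟩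
  have hxv (q' : ℤ) : ((prod (cone (quotient f)) (path (quotient f))).dv p q q').hom x = 0 := by
    obtain ⟨a, ha⟩ := hv q'
    rw [hx, comm_v_apply, ← ha, h₀]
  -- The cone component is a vertical boundary by contractibility of columns. In the path component
  -- d_v vanishes, so d_h b being a vertical boundary modulo A makes it a horizontal cycle, hence a
  -- horizontal boundary.
  obtain ⟨u, hu⟩ := exists_dv_eq_of_mem_vCycles_cone _ x.1
    (mem_vCycles_iff.2 fun q' => congrArg Prod.fst (hxv q'))
  obtain ⟨w, hw⟩ := exists_dh_eq_path x.2 fun j => by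
    obtain ⟨u, a, hu⟩ := hh j
    have e := comm_h_apply sq.lift p j q b
    rw [← hx, hu, map_add, h₀, add_zero, ← comm_v_apply] at e
    exact (congrArg Prod.snd e).trans (path_dv _)
  obtain ⟨U, hU₁, hU₂⟩ : ∃ U : (prod (cone (quotient f)) (path (quotient f))).X p (q + 1),
    U.1 = u ∧ U.2 = 0 := ⟨(u, 0), rfl, rfl⟩
  obtain ⟨W, hW₁, hW₂⟩ : ∃ W : (prod (cone (quotient f)) (path (quotient f))).X (p + 1) q,
    W.1 = 0 ∧ W.2 = w := ⟨(0, w), rfl, rfl⟩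
  obtain ⟨u', hu'⟩ := quotientπ_surjective f p (q + 1) ((g.f p (q + 1)).hom U)
  obtain ⟨w', hw'⟩ := quotientπ_surjective f (p + 1) q ((g.f (p + 1) q).hom W)
  have key : x = ((prod (cone (quotient f)) (path (quotient f))).dv p (q + 1) q).hom U +
      ((prod (cone (quotient f)) (path (quotient f))).dh (p + 1) p q).hom W := by
    refine Prod.ext ?_ ?_
    · change x.1 = ((cone (quotient f)).dv p (q + 1) q).hom U.1 +
        ((cone (quotient f)).dh (p + 1) p q).hom W.1
      rw [hU₁, hW₁, hu, map_zero, add_zero]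
    · change x.2 = ((path (quotient f)).dv p (q + 1) q).hom U.2 +
        ((path (quotient f)).dh (p + 1) p q).hom W.2
      rw [hU₂, hW₂, hw, map_zero, zero_add]
  obtain ⟨a, ha⟩ : ∃ a, b = ((B.dv p (q + 1) q).hom u' + (B.dh (p + 1) p q).hom w') +
      (f.f p q).hom a := by
    rw [← quotientπ_eq_iff, map_add, ← comm_v_apply, ← comm_h_apply, hu', hw', comm_v_apply,
      comm_h_apply, ← map_add, ← key, hx, hg]
  refine ⟨u', w', a, ha, fun q' => ?_⟩
  obtain ⟨a, ha⟩ : ∃ a, (B.dv (p + 1) q q').hom w' = 0 + (f.f (p + 1) q').hom a := by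
    rw [← quotientπ_eq_iff, ← comm_v_apply, hw', comm_v_apply, map_zero]
    refine Eq.trans (congrArg _ ?_) (map_zero (g.f (p + 1) q').hom)
    refine Prod.ext ?_ (path_dv _)
    exact (congrArg _ hW₁).trans (map_zero ((cone (quotient f)).dv (p + 1) q q').hom)
  exact ⟨a, by rw [ha, zero_add]⟩

/-- A morphism having the left lifting property with respect to fibrations is a weak
equivalence. -/
theorem isHorizontalHomologyIso_of_llp
    (hf : ∀ {X Y : Bicomplex.{u} k} (g : X ⟶ Y), RowLift g → CyclesSurjective g →
      HasLiftingProperty f g) : IsHorizontalHomologyIso vHomologyRow f := by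
  obtain ⟨s, h₁, h₂, h₃⟩ := exists_cover_section (f := f)
    fun g hg hg' => hf g hg (cyclesLift_iff.1 hg').1
  have hi := injective_of_cover h₁
  -- A retraction of f compatible with d_v, though not with d_h.
  obtain ⟨r, hr⟩ : ∃ r : ∀ p q, B.X p q →ₗ[k] A.X p q,
    r = fun p q => LinearMap.snd k _ _ ∘ₗ s p q := ⟨_, rfl⟩
  have hrf (p : ℕ) (q : ℤ) (a : A.X p q) : r p q ((f.f p q).hom a) = a := by
    rw [hr]
    exact congrArg Prod.snd (h₁ p q a)
  have hrv (p : ℕ) (q : ℤ) (b : B.X p (q + 1)) :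
      r p q ((B.dv p (q + 1) q).hom b) = (A.dv p (q + 1) q).hom (r p (q + 1) b) := by
    rw [hr]
    exact congrArg Prod.snd (h₃ p q b)
  -- Replacing w by w - f(r(w)) makes it a vertical cycle, since d_v w comes from A; then a is one
  -- too, by injectivity of f.
  have key (p : ℕ) (q : ℤ) (b : B.X p q) (hb : b ∈ B.vCycles p q)
      (hh : ∀ j, ∃ u a, (B.dh p j q).hom b = (B.dv j (q + 1) q).hom u + (f.f j q).hom a) :
      ∃ u, ∃ w ∈ B.vCycles (p + 1) q, ∃ a ∈ A.vCycles p q,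
        b = (B.dv p (q + 1) q).hom u + (B.dh (p + 1) p q).hom w + (f.f p q).hom a := by
    obtain ⟨q, rfl⟩ : ∃ r, q = r + 1 := ⟨q - 1, by omega⟩
    obtain ⟨u, w, a, e, hw⟩ := exists_eq_dv_add_dh_of_llp hf b
      (fun q' => ⟨0, by rw [map_zero, mem_vCycles_iff.1 hb]⟩) hh
    obtain ⟨a₀, ha₀⟩ := hw q
    have hw' : w - (f.f (p + 1) (q + 1)).hom (r _ _ w) ∈ B.vCycles (p + 1) (q + 1) := by
      rw [mem_vCycles_succ, map_sub, comm_v_apply, ← hrv, ← ha₀, hrf, sub_self]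
    have e' : b = (B.dv p (q + 1 + 1) (q + 1)).hom u + (B.dh (p + 1) p (q + 1)).hom
        (w - (f.f (p + 1) (q + 1)).hom (r _ _ w)) +
          (f.f p (q + 1)).hom (a + (A.dh (p + 1) p (q + 1)).hom (r _ _ w)) := by
      rw [map_sub, map_add, ← comm_h_apply, e]
      abel
    refine ⟨u, _, hw', _, mem_vCycles_succ.2 (hi p q ?_), e'⟩
    have h := congrArg (B.dv p (q + 1) q).hom e'
    rw [mem_vCycles_succ.1 hb, map_add, map_add, dv_dv_apply, dv_dh_apply,
      mem_vCycles_succ.1 hw', map_zero, neg_zero, add_zero, zero_add] at h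
    rw [← comm_v_apply, map_zero, ← h]
  intro p q
  rw [isIso_homologyMap_iff]
  constructor
  · rintro a ha ⟨c, hc⟩
    obtain ⟨x, hx, rfl⟩ := exists_vClass a
    obtain ⟨y, hy, rfl⟩ := exists_vClass c
    obtain ⟨v, hv⟩ := vHomologyRow_d_eq_map_iff.1 hc
    obtain ⟨v', hv'⟩ : ∃ v', (f.f p q).hom x = (B.dh (p + 1) p q).hom y +
      (B.dv p (q + 1) q).hom v' := ⟨- v, by rw [hv, map_neg, add_neg_cancel_right]⟩
    -- The element `y` is a relative cycle, and its A-part `a` is the required preimage: f(x - d_h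
    -- a) is the vertical boundary of v' - d_h u, and r carries this relation back to A.
    obtain ⟨u, t, ht, a, ha', e⟩ := key (p + 1) q y hy fun j => by
      by_cases hj : j + 1 = p + 1
      · obtain rfl : j = p := by omega
        exact ⟨- v', x, by rw [hv', map_neg]; abel⟩
      · exact ⟨0, 0, by rw [map_zero, map_zero, add_zero, dh_apply_eq_zero _ _ hj]⟩
    refine ⟨vClass a ha', vHomologyRow_d_eq_iff.2 ⟨- r p (q + 1)
      (v' - (B.dh (p + 1) p (q + 1)).hom u), ?_⟩⟩
    rw [map_neg, ← hrv, eq_add_neg_iff_add_eq, ← hrf p q ((A.dh (p + 1) p q).hom a), ← map_add,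
      ← hrf p q x, hv', ← comm_h_apply]
    congr 1
    rw [e, map_sub, map_add, map_add, dh_dh_apply, dv_dh_apply]
    abel
  · intro b hb
    obtain ⟨y, hy, rfl⟩ := exists_vClass b
    -- Here `a` represents the preimage class. It is a horizontal cycle in vertical homology because
    -- f(d_h a) is a vertical boundary in B, which r carries to A.
    obtain ⟨u, w, hw, a, ha, e⟩ := key p q y hy fun j => by
      obtain ⟨u, hu⟩ := vHomologyRow_d_eq_zero_iff.1 (hb j)
      exact ⟨u, 0, by rw [hu, map_zero, add_zero]⟩
    refine ⟨vClass a ha, fun j => vHomologyRow_d_eq_zero_iff.2 ?_, vClass w hw,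
      (vClass_eq_iff (x := (f.f p q).hom a + (B.dh (p + 1) p q).hom w)
        (hx := add_mem (map_mem_vCycles f _ _ _ ha) (dh_mem_vCycles _ _ _ _ _ hw))).2 ⟨- u, ?_⟩⟩
    · obtain ⟨v, hv⟩ := vHomologyRow_d_eq_zero_iff.1 (hb j)
      refine ⟨r j (q + 1) (v + (B.dh p j (q + 1)).hom u), ?_⟩
      rw [← hrv, map_add, dv_dh_apply, ← hv, ← sub_eq_add_neg, ← map_sub,
        ← hrf j q ((A.dh p j q).hom a), ← comm_h_apply]
      congr 1
      rw [e, map_sub, map_add, map_add, dh_dh_apply]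
      abel
    · rw [e, map_neg]
      abel

end Acyclicity

end Bicomplex

/-! ### Assembly of the model structure -/

namespace Bicomplex

open MorphismProperty

variable (k : Type u) [CommRing k]

/-- The morphisms inducing an isomorphism on the horizontal homology of vertical homology. -/
def horizontalVerticalEquivalences : MorphismProperty (Bicomplex.{u} k) :=
  fun _ _ f => IsHorizontalHomologyIso vHomologyRow f

instance : (horizontalVerticalEquivalences k).HasTwoOutOfThreeProperty where
  comp_mem f g hf hg p q := by
    have := hf p q
    have := hg p q
    rw [Functor.map_comp, HomologicalComplex.homologyMap_comp]
    infer_instance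
  of_postcomp f g hg hfg p q := by
    have := hg p q
    have := hfg p q
    rw [Functor.map_comp, HomologicalComplex.homologyMap_comp] at this
    exact IsIso.of_isIso_comp_right _ (HomologicalComplex.homologyMap ((vHomologyRow q).map g) p)
  of_precomp f g hf hfg p q := by
    have := hf p q
    have := hfg p q
    rw [Functor.map_comp, HomologicalComplex.homologyMap_comp] at this
    exact IsIso.of_isIso_comp_left (HomologicalComplex.homologyMap ((vHomologyRow q).map f) p) _

lemma genTrivCof_rlp_inf : (genTrivCof k).rlp ⊓ horizontalVerticalEquivalences k =
    (genCof k).rlp := by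
  ext X Y f
  refine Iff.trans ?_ genCof_rlp_iff.symm
  exact (and_congr_left' genTrivCof_rlp_iff).trans fibration_and_weakEquivalence_iff

lemma genCof_rlp_le : (genCof k).rlp ≤ (genTrivCof k).rlp := by
  rw [← genTrivCof_rlp_inf]
  exact inf_le_left

lemma genTrivCof_rlp_llp_le :
    (genTrivCof k).rlp.llp ≤ horizontalVerticalEquivalences k := fun _ _ _ hf =>
  isHorizontalHomologyIso_of_llp fun g h₁ h₂ => hf g (genTrivCof_rlp_iff.2 ⟨h₁, h₂⟩)

/-- The retract argument. Factor f as a map lifting against fibrations followed by a fibration; by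
two out of three the fibration is trivial, so f lifts against it and is a retract of the first
factor. -/
lemma genCof_rlp_llp_inf : (genCof k).rlp.llp ⊓ horizontalVerticalEquivalences k =
    (genTrivCof k).rlp.llp := by
  refine le_antisymm (fun X Y f hf => ?_)
    (le_inf (antitone_llp (genCof_rlp_le k)) (genTrivCof_rlp_llp_le k))
  let h := factorizationData (genTrivCof k).rlp.llp (genTrivCof k).rlp f
  have hp : (genCof k).rlp h.p := by
    rw [← genTrivCof_rlp_inf]
    refine ⟨h.hp, of_precomp (horizontalVerticalEquivalences k)
      (W' := horizontalVerticalEquivalences k) h.i h.p (genTrivCof_rlp_llp_le k _ h.hi) ?_⟩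
    rw [h.fac]
    exact hf.2
  have := hf.1 h.p hp
  exact of_retract (RetractArrow.ofLeftLiftingProperty h.fac) h.hi

/-- The Cartan–Eilenberg model structure on bicomplexes. -/
@[reducible]
noncomputable def cartanEilenbergModelCategory : ModelCategory (Bicomplex.{u} k) :=
  letI : CategoryWithFibrations (Bicomplex.{u} k) := ⟨(genTrivCof k).rlp⟩
  letI : CategoryWithCofibrations (Bicomplex.{u} k) := ⟨(genCof k).rlp.llp⟩
  letI : CategoryWithWeakEquivalences (Bicomplex.{u} k) := ⟨horizontalVerticalEquivalences k⟩
  haveI : (weakEquivalences (Bicomplex.{u} k)).HasTwoOutOfThreeProperty :=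
    inferInstanceAs (horizontalVerticalEquivalences k).HasTwoOutOfThreeProperty
  haveI : IsWeakFactorizationSystem (cofibrations (Bicomplex.{u} k))
      (trivialFibrations (Bicomplex.{u} k)) := by
    change IsWeakFactorizationSystem (genCof k).rlp.llp
      ((genTrivCof k).rlp ⊓ horizontalVerticalEquivalences k)
    rw [genTrivCof_rlp_inf]
    exact { rlp := rlp_llp_rlp _, llp := rfl }
  haveI : IsWeakFactorizationSystem (trivialCofibrations (Bicomplex.{u} k))
      (fibrations (Bicomplex.{u} k)) := by
    change IsWeakFactorizationSystem ((genCof k).rlp.llp ⊓ horizontalVerticalEquivalences k)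
      (genTrivCof k).rlp
    rw [genCof_rlp_llp_inf]
    exact { rlp := rlp_llp_rlp _, llp := rfl }
  .mk' _

lemma isCombinatorialModelCategory_cartanEilenberg :
    letI := cartanEilenbergModelCategory k
    IsCombinatorialModelCategory.{u} (Bicomplex.{u} k) := by
  let _ := cartanEilenbergModelCategory k
  have h : trivialFibrations (Bicomplex.{u} k) = (genCof k).rlp := genTrivCof_rlp_inf k
  have h' : trivialCofibrations (Bicomplex.{u} k) = (genTrivCof k).rlp.llp :=
    genCof_rlp_llp_inf k
  exact
    { hasLimits := inferInstance
      hasColimits := inferInstance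
      functorialFactorization_trivialCofibrations := by
        rw [h']
        exact inferInstanceAs (HasFunctorialFactorization (genTrivCof k).rlp.llp
          (genTrivCof k).rlp)
      functorialFactorization_trivialFibrations := by
        rw [h]
        exact inferInstanceAs (HasFunctorialFactorization (genCof k).rlp.llp (genCof k).rlp)
      locallyPresentable := inferInstance
      cofibrantlyGenerated := ⟨genCof k, genTrivCof k, inferInstance, inferInstance,
        inferInstance, inferInstance, h, rfl⟩ }

end Bicomplex

theorem theorem4p1 (k : Type u) [CommRing k] :
    ∃ (_ : ModelCategory (Bicomplex.{u} k)),
      IsCombinatorialModelCategory.{u} (Bicomplex.{u} k) ∧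
      (∀ {X Y : Bicomplex.{u} k} (f : X ⟶ Y), weakEquivalences (Bicomplex.{u} k) f ↔
        Bicomplex.IsHorizontalHomologyIso Bicomplex.vHomologyRow f) ∧
      (∀ {X Y : Bicomplex.{u} k} (f : X ⟶ Y), fibrations (Bicomplex.{u} k) f ↔
        (∀ (p : ℕ) (q : ℤ), Function.Surjective (f.f p q)) ∧
        (∀ (p : ℕ) (q : ℤ), 0 < p →
          Function.Surjective (((Bicomplex.vCyclesRow q).map f).f p)) ∧
        Bicomplex.IsHorizontalHomologyIso Bicomplex.row f) ∧
      (∀ {X Y : Bicomplex.{u} k} (f : X ⟶ Y), trivialFibrations (Bicomplex.{u} k) f ↔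
        ((∀ (p : ℕ) (q : ℤ), Function.Surjective (f.f p q)) ∧
          (∀ (p : ℕ) (q : ℤ), 0 < p →
            Function.Surjective (((Bicomplex.vCyclesRow q).map f).f p)) ∧
          Bicomplex.IsHorizontalHomologyIso Bicomplex.row f) ∧
        Bicomplex.IsHorizontalHomologyIso Bicomplex.vCyclesRow f) ∧
      (∀ {X Y : Bicomplex.{u} k} (f : X ⟶ Y), cofibrations (Bicomplex.{u} k) f →
        (∀ (p : ℕ) (q : ℤ), Function.Injective (f.f p q)) ∧
        (∀ (p : ℕ) (q : ℤ), Function.Injective (((Bicomplex.vHomologyRow q).map f).f p)) ∧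
        (∀ (p : ℕ) (q : ℤ), HasProjectiveCokernel (((Bicomplex.vBoundariesRow q).map f).f p)) ∧
        (∀ (p : ℕ) (q : ℤ), HasProjectiveCokernel (((Bicomplex.vHomologyRow q).map f).f p))) := by
  have hfib {X Y : Bicomplex.{u} k} (f : X ⟶ Y) : (Bicomplex.genTrivCof k).rlp f ↔
      (∀ (p : ℕ) (q : ℤ), Function.Surjective (f.f p q)) ∧
        (∀ (p : ℕ) (q : ℤ), 0 < p →
          Function.Surjective (((Bicomplex.vCyclesRow q).map f).f p)) ∧
        Bicomplex.IsHorizontalHomologyIso Bicomplex.row f := by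
    rw [Bicomplex.genTrivCof_rlp_iff, Bicomplex.rowLift_iff, Bicomplex.cyclesSurjective_iff,
      and_assoc, and_comm (a := Bicomplex.IsHorizontalHomologyIso _ _)]
  refine ⟨Bicomplex.cartanEilenbergModelCategory k,
    Bicomplex.isCombinatorialModelCategory_cartanEilenberg k, fun _ => Iff.rfl, hfib,
    fun f => ?_, fun {X Y} f hf => ?_⟩
  · change ((Bicomplex.genTrivCof k).rlp ⊓ Bicomplex.horizontalVerticalEquivalences k) f ↔ _
    rw [Bicomplex.genTrivCof_rlp_inf, Bicomplex.genCof_rlp_iff, Bicomplex.cyclesLift_iff,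
      ← hfib, Bicomplex.genTrivCof_rlp_iff, and_assoc]
  -- A cofibration lifts against trivial fibrations, which is all that the vertical splitting
  -- requires.
  · obtain ⟨s, h₁, h₂, h₃⟩ := Bicomplex.exists_cover_section (f := f) fun g hg hg' =>
      hf g (Bicomplex.genCof_rlp_iff.2 ⟨hg, hg'⟩)
    exact ⟨Bicomplex.injective_of_cover h₁, Bicomplex.vHomologyRow_injective_of_cover h₁ h₃,
      Bicomplex.hasProjectiveCokernel_vBoundariesRow_of_cover h₁ h₂ h₃,
      Bicomplex.hasProjectiveCokernel_vHomologyRow_of_cover h₁ h₂ h₃⟩
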